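/- Setting. Let $q=2^s$, $s\ge 1$. The $q$-ary multi-bit channel (QMBC) with partial-erasure probabilities $\varepsilon_0,\dots,\varepsilon_s\ge 0$, $\sum_{j=0}^s\varepsilon_j=1$, has input alphabet $\{0,\dots,q-1\}$; on input $x$ it outputs, with probability $\varepsilon_j$, the set $\mathcal M_x^j$ of the $2^j$ symbols that have the same $s-j$ leftmost bits as $x$. Its capacity (maximal mutual information, in base-$q$ units) is denoted $C(\varepsilon)$. Let $\alpha$ be a primitive element of $\mathrm{GF}(q)$ and let $\mathcal M_0^j\subseteq \mathrm{GF}(q)$ be the additive subgroup of polynomials in $\alpha$ of degree at most $j-1$ over $\mathrm{GF}(2)$. Let $\lambda(x)=\sum_{i\ge2}\lambda_i x^{i-1}$, $\rho(x)=\sum_{i\ge 2}\rho_i x^{i-1}$ be edge-perspective degree-distribution polynomials (nonnegative coefficients, $\lambda(1)=\rho(1)=1$), with design rate $R(\lambda,\rho)=1-\frac{\sum_i\rho_i/i}{\sum_i\lambda_i/i}$. The edge labels are i.i.d. with a distribution $\mathbb L$ on $\mathrm{GF}(q)\setminus\{0\}$. QMBC density evolution tracks the distribution $z^{(l)}$,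 over the additive subgroups of $\mathrm{GF}(q)$, of the variable-to-check message at iteration $l$ when the all-zero codeword is sent: the initial message is $\mathcal M_0^j$ with probability $\varepsilon_j$; the message from a check node along an edge labelled $h$ is the sumset $\sum_k (h_k/h)H_k$ of its other incoming messages $H_k$ on edges labelled $h_k$; the message from a variable node is the intersection of its channel subgroup with its other incoming messages; all messages entering a node are independent. Let $P^{(l)}_{\rm error}=1-z^{(l)}(\{0\})$, let $\Omega_{\mathbb L}(\lambda,\rho)$ be the set of $(\varepsilon_j)$ for which $P^{(l)}_{\rm error}\to0$, and let $\Omega(\lambda,\rho)=\bigcup_{\mathbb L}\Omega_{\mathbb L}(\lambda,\rho)$. Let $\varepsilon_{\rm BEC}(\lambda,\rho)$ be the supremum of the $\varepsilon\in[0,1]$ for which the BEC recursion $x_{l+1}=\varepsilon\lambda(1-\rho(1-x_l))$, $x_0=\varepsilon$, tends to $0$. Theorem. Suppose that $j_{\max}\ge1$ divides $s$ and that $\varepsilon_{j_{\max}}=\varepsilon\in[0,1]$ is the only nonzero partial-erasure probability (so $\varepsilon_0=1-\varepsilon$). Let $\mathbb L^*$ be the uniform distribution on $\{\alpha^{t j_{\max}}\}_{t=0}^{s/j_{\max}-1}$.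 (1) For all $(\lambda,\rho)$ and $\varepsilon\in[0,1]$, density evolution under $\mathbb L^*$ satisfies $z^{(l)}(\mathcal M_0^{j_{\max}})=y_l=P^{(l)}_{\rm error}$ and $z^{(l)}(\{0\})=1-y_l$, with every other subgroup having probability $0$, where $$y_0=\varepsilon,\qquad y_{l+1}=\varepsilon\,\lambda\!\left(1-\rho\!\left(1-\frac{y_l}{s/j_{\max}}\right)\right).$$ (2) Consequently such a channel lies in $\Omega_{\mathbb L^*}(\lambda,\rho)$ if and only if the BEC recursion for $(\lambda,\rho)$ with erasure probability $\varepsilon j_{\max}/s$ tends to $0$, and the threshold in $\varepsilon$ under $\mathbb L^*$ (the supremum of the decodable $\varepsilon\in[0,1]$) is $\min\{1,\frac{s}{j_{\max}}\varepsilon_{\rm BEC}(\lambda,\rho)\}$. (3) $\mathbb L^*$ is optimal with respect to achieving capacity: let $(\lambda^{(n)},\rho^{(n)})$ be any sequence that is capacity-achieving on the BEC with erasure probability $\delta$, i.e. $\varepsilon_{\rm BEC}(\lambda^{(n)},\rho^{(n)})\to\delta$ and $R(\lambda^{(n)},\rho^{(n)})\to 1-\delta$, where $\frac{s}{j_{\max}}\delta\le1$.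 Then, with $\mathbb L^*$, it is capacity-achieving on the QMBC with $\varepsilon_{j_{\max}}=\frac{s}{j_{\max}}\delta$ the only nonzero partial-erasure probability: the thresholds under $\mathbb L^*$ tend to $\frac{s}{j_{\max}}\delta$ and the design rates tend to the capacity $C$ of that channel. Moreover the thresholds in $\varepsilon_{j_{\max}}$ of the full regions $\Omega(\lambda^{(n)},\rho^{(n)})$ (best choice of $\mathbb L$ for each $\varepsilon$ and $n$) also tend to $\frac{s}{j_{\max}}\delta$. -/

import Mathlib

open Filter Topology

namespace QMBC

noncomputable section

/-! ### The channel on the alphabet `{0, …, 2^s - 1}` and its capacity -/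

/-- The output set of a type-`j` partial erasure of the symbol `x`: all symbols whose `s - j`
leftmost bits agree with those of `x`. -/
def outputSet (s j : ℕ) (x : Fin (2 ^ s)) : Finset (Fin (2 ^ s)) :=
  Finset.univ.filter fun y => (y : ℕ) / 2 ^ j = (x : ℕ) / 2 ^ j

/-- Transition probability `Pr(Y = S | X = x)`, where `ε j` is the probability of a type-`j`
partial erasure, `j = 0, …, s`. -/
def transition (s : ℕ) (ε : Fin (s + 1) → ℝ) (x : Fin (2 ^ s)) (S : Finset (Fin (2 ^ s))) : ℝ :=
  ∑ j : Fin (s + 1), if outputSet s j x = S then ε j else 0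

/-- Mutual information `I(X;Y)` for the input distribution `p`, in `q`-ary units, `q = 2^s`. -/
def mutualInfo (s : ℕ) (ε : Fin (s + 1) → ℝ) (p : Fin (2 ^ s) → ℝ) : ℝ :=
  ∑ x, ∑ S : Finset (Fin (2 ^ s)), p x * transition s ε x S *
    Real.logb (2 ^ s) (transition s ε x S / ∑ x', p x' * transition s ε x' S)

/-- Capacity, in `q`-ary symbols per channel use: the supremum of the mutual information over
all input distributions. -/
def capacity (s : ℕ) (ε : Fin (s + 1) → ℝ) : ℝ :=
  sSup (mutualInfo s ε '' stdSimplex ℝ (Fin (2 ^ s)))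

/-- The channel whose only nonzero partial-erasure probability is `ε_j = x` (for `1 ≤ j ≤ s`). -/
def single (s j : ℕ) (x : ℝ) : Fin (s + 1) → ℝ :=
  fun i => if (i : ℕ) = j then x else if (i : ℕ) = 0 then 1 - x else 0

/-! ### Degree distributions -/

/-- An edge-perspective degree distribution: `coeff i` is the fraction of edges attached to
nodes of degree `i`; all degrees are at least `2` and bounded. -/
structure DegreeDist where
  coeff : ℕ →₀ ℝ
  nonneg : ∀ i, 0 ≤ coeff i
  two_le : ∀ i ∈ coeff.support, 2 ≤ i
  sum_eq_one : ∑ i ∈ coeff.support, coeff i = 1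

/-- The polynomial `∑ i, coeff i * x^(i-1)`. -/
def DegreeDist.eval (d : DegreeDist) (x : ℝ) : ℝ :=
  ∑ i ∈ d.coeff.support, d.coeff i * x ^ (i - 1)

/-- `∑ i, coeff i / i`. -/
def DegreeDist.integral (d : DegreeDist) : ℝ :=
  ∑ i ∈ d.coeff.support, d.coeff i / i

/-- Design rate, in `q`-ary symbols per channel use. -/
def designRate (lam rho : DegreeDist) : ℝ :=
  1 - rho.integral / lam.integral

/-! ### Density evolution on the binary erasure channel -/

/-- BEC density evolution: erasure probability of a variable-to-check message. -/
def bec (lam rho : DegreeDist) (ε : ℝ) : ℕ → ℝ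
  | 0 => ε
  | l + 1 => ε * lam.eval (1 - rho.eval (1 - bec lam rho ε l))

/-- The BEC decoding threshold. -/
def becThreshold (lam rho : DegreeDist) : ℝ :=
  sSup {ε | ε ∈ Set.Icc (0 : ℝ) 1 ∧ Tendsto (bec lam rho ε) atTop (𝓝 0)}

/-- The sequence of degree-distribution pairs achieves capacity on BEC(`δ`): the thresholds tend
to `δ` and the design rates tend to the capacity `1 - δ`. -/
def BECCapacityAchieving (lam rho : ℕ → DegreeDist) (δ : ℝ) : Prop :=
  Tendsto (fun n => becThreshold (lam n) (rho n)) atTop (𝓝 δ) ∧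
    Tendsto (fun n => designRate (lam n) (rho n)) atTop (𝓝 (1 - δ))

/-! ### Density evolution on the multi-bit channel

Under the all-zero codeword the messages of the set decoder are additive subgroups of the field.
The supremum of subgroups is their sumset, the infimum is their intersection. -/

variable {F : Type*} [Field F]

/-- The channel subgroup `M_0^j`: polynomials in `α` of degree at most `j - 1` over GF(2), i.e.
all sums of elements of `{1, α, …, α^(j-1)}`. -/
def chanSubgroup (α : F) (j : ℕ) : AddSubgroup F :=
  AddSubgroup.closure {x | ∃ i < j, x = α ^ i}

/-- Check-to-variable message: the sumset of the incoming messages `m k`, each multiplied by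
(label of its edge) / (label of the outgoing edge). -/
def ctvMsg {n : ℕ} (hout : Fˣ) (hin : Fin n → Fˣ) (m : Fin n → AddSubgroup F) : AddSubgroup F :=
  ⨆ k, (m k).map (AddMonoidHom.mulLeft ((hin k : F) / (hout : F)))

/-- Variable-to-check message: the intersection of the channel subgroup with the incoming
messages `m k`. -/
def vtcMsg {n : ℕ} (C : AddSubgroup F) (m : Fin n → AddSubgroup F) : AddSubgroup F :=
  C ⊓ ⨅ k, m k

variable [Fintype F] [DecidableEq F]

open Classical in
/-- Probability that the outgoing message of a check node is `H`, given the incoming messages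
`m`, when the labels of all its edges are drawn independently from `L`. -/
def checkProb (L : Fˣ → ℝ) {n : ℕ} (m : Fin n → AddSubgroup F) (H : AddSubgroup F) : ℝ :=
  ∑ hout : Fˣ, ∑ hin : Fin n → Fˣ,
    L hout * (∏ k, L (hin k)) * if ctvMsg hout hin m = H then 1 else 0

open Classical in
/-- Check-node update of the message distribution `z`. -/
def checkUpdate (rho : DegreeDist) (L : Fˣ → ℝ) (z : AddSubgroup F → ℝ) (H : AddSubgroup F) : ℝ :=
  ∑ i ∈ rho.coeff.support, rho.coeff i *
    ∑ m : Fin (i - 1) → AddSubgroup F, (∏ k, z (m k)) * checkProb L m H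

open Classical in
/-- Variable-node update of the message distribution `w`. -/
def varUpdate {s : ℕ} (lam : DegreeDist) (α : F) (ε : Fin (s + 1) → ℝ) (w : AddSubgroup F → ℝ)
    (H : AddSubgroup F) : ℝ :=
  ∑ i ∈ lam.coeff.support, lam.coeff i * ∑ j : Fin (s + 1), ε j *
    ∑ m : Fin (i - 1) → AddSubgroup F,
      (∏ k, w (m k)) * if vtcMsg (chanSubgroup α j) m = H then 1 else 0

open Classical in
/-- Density evolution: the probability that a variable-to-check message at iteration `l` is the
subgroup `H`. -/
def vtcProb {s : ℕ} (lam rho : DegreeDist) (α : F) (L : Fˣ → ℝ) (ε : Fin (s + 1) → ℝ) :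
    ℕ → AddSubgroup F → ℝ
  | 0 => fun H => ∑ j : Fin (s + 1), if chanSubgroup α j = H then ε j else 0
  | l + 1 => varUpdate lam α ε (checkUpdate rho L (vtcProb lam rho α L ε l))

open Classical in
/-- Probability of decoding failure at iteration `l`: the message is not `{0}`. -/
def errorProb {s : ℕ} (lam rho : DegreeDist) (α : F) (L : Fˣ → ℝ) (ε : Fin (s + 1) → ℝ)
    (l : ℕ) : ℝ :=
  ∑ H ∈ Finset.univ.filter (fun H : AddSubgroup F => H ≠ ⊥), vtcProb lam rho α L ε l H

/-- The region of partial-erasure probabilities (with `ε_0 = 1 - ∑_{j ≥ 1} ε_j`) that are decoded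
with label distribution `L`. -/
def labelRegion (s : ℕ) (lam rho : DegreeDist) (α : F) (L : Fˣ → ℝ) : Set (Fin (s + 1) → ℝ) :=
  {ε | ε ∈ stdSimplex ℝ (Fin (s + 1)) ∧ Tendsto (errorProb lam rho α L ε) atTop (𝓝 0)}

/-- The decoding-threshold region: the union of `labelRegion` over all label distributions. -/
def region (s : ℕ) (lam rho : DegreeDist) (α : F) : Set (Fin (s + 1) → ℝ) :=
  ⋃ L ∈ stdSimplex ℝ Fˣ, labelRegion s lam rho α L

/-- The threshold in `ε_j` of a region when all other partial-erasure probabilities are zero. -/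
def axisThreshold (s j : ℕ) (Ω : Set (Fin (s + 1) → ℝ)) : ℝ :=
  sSup {x | x ∈ Set.Icc (0 : ℝ) 1 ∧ single s j x ∈ Ω}

/-- The label set `{α^(t·j) : t = 0, …, s/j - 1}`. -/
def optLabelSet (α : F) (s j : ℕ) : Finset Fˣ :=
  Finset.univ.filter fun h => ∃ t < s / j, (h : F) = α ^ (t * j)

/-- The uniform distribution on `optLabelSet`. -/
def optLabels (α : F) (s j : ℕ) (h : Fˣ) : ℝ :=
  if h ∈ optLabelSet α s j then ((optLabelSet α s j).card : ℝ)⁻¹ else 0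

end

end QMBC

/-! Reduction to the BEC. Write `M` for `chanSubgroup α j`. Since `α` is primitive, `1, α, …,
α^(s-1)` is a basis of `F` over GF(2), and multiplication by `α^(t·j)` carries `M` onto the span of
the exponents in `[t·j, t·j+j)`. These `s/j` blocks partition the basis. So with optimal labels and
inputs in `{⊥, M}`, a check message contains `M` when some input equal to `M` has the label of the
output edge, and meets `M` trivially otherwise (`chanSubgroup_le_ctvMsg`,
`chanSubgroup_inf_ctvMsg`). Intersecting with the channel subgroup therefore returns `⊥` or `M`. Two
labels agree with probability `j/s`, which gives `scalarDE`; multiplied by `j/s`, this is the BEC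
recursion (`scalarDE_mul`).

Capacity. The size of the output set reveals the erasure type, so the mutual information splits into
a block entropy and a symbol entropy. The uniform input maximises both (`capacity_single`).

Converse, for an arbitrary label distribution. The function `dim` is modular on the subgroup
lattice, so losses of dimension at a node compare with the sum of the losses along single edges
(`sum_dim_vtc_le`, `sum_dim_ctv_le`). Averaged over a monotone coupling, this shows that `potential`
does not decrease along density evolution started from the point mass at `⊤`
(`potential_le_of_stochLE`). If decoding succeeds the potential tends to its value `0` at the point
mass at `⊥`, so its value at `⊤` is at most `0`. That value compares the average channel dimension
with the number of checks, and the inequality reads `x ≤ (s/j)(1 - R)`, with `R` the design rate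
(`le_of_single_mem_region`). For capacity-achieving sequences this upper bound and the threshold
under `optLabels` have the same limit. -/

namespace QMBC

/-! ### Modularity of the dimension on the lattice of subgroups. -/

section Rank

variable {G : Type*} [AddCommGroup G]

/-- The base-2 logarithm of the order of a subgroup. -/
noncomputable def dim (H : AddSubgroup G) : ℝ := Real.logb 2 (Nat.card H)

@[simp] lemma dim_bot : dim (⊥ : AddSubgroup G) = 0 := by simp [dim]

lemma dim_map {G' : Type*} [AddCommGroup G'] (f : G →+ G') (hf : Function.Injective f)
    (H : AddSubgroup G) : dim (H.map f) = dim H := by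
  unfold dim
  rw [Nat.card_congr (H.equivMapOfInjective f hf).toEquiv]

variable [Finite G]

lemma dim_mono {A B : AddSubgroup G} (h : A ≤ B) : dim A ≤ dim B := by
  unfold dim
  have h1 : 0 < Nat.card A := Nat.card_pos
  have h2 : Nat.card A ≤ Nat.card B := Nat.card_le_card_of_injective _
    (AddSubgroup.inclusion_injective h)
  exact Real.logb_le_logb_of_le (by norm_num) (by exact_mod_cast h1) (by exact_mod_cast h2)

/-- Second isomorphism theorem in index form: `B` has the same relative index in `A ⊔ B` as in `A`.
-/
lemma dim_sup_add_dim_inf (A B : AddSubgroup G) : dim (A ⊔ B) + dim (A ⊓ B) = dim A + dim B := by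
  have h1 := AddSubgroup.relIndex_inf_mul_relIndex ⊥ B (A ⊔ B)
  have h2 := AddSubgroup.relIndex_inf_mul_relIndex ⊥ B A
  rw [AddSubgroup.relIndex_sup_right, inf_eq_left.2 le_sup_right] at h1
  simp only [bot_inf_eq, AddSubgroup.relIndex_bot_left] at h1 h2
  have h3 : Nat.card ↥(A ⊔ B) * Nat.card ↥(A ⊓ B) = Nat.card A * Nat.card B := by
    rw [← h1, ← h2, inf_comm]; ring
  have p : ∀ H : AddSubgroup G, (Nat.card H : ℝ) ≠ 0 := fun H =>
    Nat.cast_ne_zero.2 Nat.card_pos.ne'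
  unfold dim
  rw [← Real.logb_mul (p _) (p _), ← Real.logb_mul (p _) (p _)]
  exact_mod_cast congrArg (fun n : ℕ => Real.logb 2 n) h3

/-- Diminishing returns: apply modularity to `X ⊔ A` and `Y ⊔ B`, whose join is `Y ⊔ A` and whose
meet contains `X ⊔ B`. -/
lemma dim_sup_sub_le {X Y A B : AddSubgroup G} (hXY : X ≤ Y) (hBA : B ≤ A) :
    dim (Y ⊔ A) - dim (Y ⊔ B) ≤ dim (X ⊔ A) - dim (X ⊔ B) := by
  have h := dim_sup_add_dim_inf (X ⊔ A) (Y ⊔ B)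
  have h1 : X ⊔ A ⊔ (Y ⊔ B) = Y ⊔ A :=
    le_antisymm (sup_le (sup_le_sup_right hXY A) (sup_le_sup_left hBA Y))
      (sup_le (le_sup_left.trans le_sup_right) (le_sup_right.trans le_sup_left))
  have h2 : dim (X ⊔ B) ≤ dim ((X ⊔ A) ⊓ (Y ⊔ B)) :=
    dim_mono (le_inf (sup_le_sup_left hBA X) (sup_le_sup_right hXY B))
  rw [h1] at h
  linarith

lemma iSup_eq_sup_succAbove {L : Type*} [CompleteLattice L] {n : ℕ} (A : Fin (n + 1) → L)
    (k : Fin (n + 1)) : ⨆ i, A i = A k ⊔ ⨆ i, A (k.succAbove i) := by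
  refine le_antisymm (iSup_le fun i => ?_) (sup_le (le_iSup A k) (iSup_le fun i => le_iSup A _))
  obtain rfl | ⟨j, rfl⟩ := Fin.eq_self_or_eq_succAbove k i
  · exact le_sup_left
  · exact le_sup_of_le_right (le_iSup (fun i => A (k.succAbove i)) j)

lemma iInf_eq_inf_succAbove {L : Type*} [CompleteLattice L] {n : ℕ} (A : Fin (n + 1) → L)
    (k : Fin (n + 1)) : ⨅ i, A i = A k ⊓ ⨅ i, A (k.succAbove i) :=
  iSup_eq_sup_succAbove (L := Lᵒᵈ) A k

/-- Codimensions inside `A` are subadditive under intersection, because the join of two subgroups of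
`A` stays inside `A`. -/
lemma sum_dim_inf_sub_le {ι : Type*} (A : AddSubgroup G) (B : ι → AddSubgroup G) (S : Finset ι) :
    ∑ k ∈ S, (dim (A ⊓ B k) - dim A) ≤ dim (A ⊓ S.inf B) - dim A := by
  classical
  induction S using Finset.induction_on with
  | empty => simp
  | insert a S ha ih =>
    rw [Finset.sum_insert ha, Finset.inf_insert]
    have h := dim_sup_add_dim_inf (A ⊓ B a) (A ⊓ S.inf B)
    have h1 : dim (A ⊓ B a ⊔ A ⊓ S.inf B) ≤ dim A := dim_mono (sup_le inf_le_left inf_le_left)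
    rw [← inf_inf_distrib_left] at h
    linarith

/-- Shrinking all the incoming messages of a variable node changes the dimension of the
intersection by at least the sum of the changes caused by shrinking one message at a time. -/
lemma sum_dim_vtc_le {n : ℕ} (C : AddSubgroup G) {a b : Fin (n + 1) → AddSubgroup G}
    (hab : ∀ k, a k ≤ b k) :
    ∑ k, (dim (a k ⊓ (C ⊓ ⨅ i, b (k.succAbove i))) - dim (b k ⊓ (C ⊓ ⨅ i, b (k.succAbove i))))
      ≤ dim (C ⊓ ⨅ k, a k) - dim (C ⊓ ⨅ k, b k) := by
  have h := sum_dim_inf_sub_le (C ⊓ ⨅ k, b k) a Finset.univ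
  have e : C ⊓ (⨅ k, b k) ⊓ Finset.univ.inf a = C ⊓ ⨅ k, a k := by
    rw [Finset.inf_univ_eq_iInf, inf_assoc, inf_eq_right.2 (iInf_mono hab)]
  rw [e] at h
  refine le_of_eq_of_le (Finset.sum_congr rfl fun k _ => ?_) h
  have e1 : b k ⊓ (C ⊓ ⨅ i, b (k.succAbove i)) = C ⊓ ⨅ k, b k := by
    rw [iInf_eq_inf_succAbove b k, inf_left_comm]
  have e2 : a k ⊓ (C ⊓ ⨅ i, b (k.succAbove i)) = C ⊓ (⨅ k, b k) ⊓ a k := by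
    rw [← e1, inf_comm (b k), inf_assoc, inf_eq_right.2 (hab k), inf_comm]
  rw [e1, e2]

/-- Shrinking all the incoming messages of a check node changes the dimension of the space of
local codewords by at least the sum of the changes caused by shrinking one message at a time. -/
lemma sum_dim_ctv_le {n : ℕ} {a b : Fin (n + 1) → AddSubgroup G} (hab : ∀ k, a k ≤ b k) :
    ∑ k, (dim (a k ⊓ ⨆ i, b (k.succAbove i)) - dim (b k ⊓ ⨆ i, b (k.succAbove i)))
      ≤ (∑ k, dim (a k) - dim (⨆ k, a k)) - (∑ k, dim (b k) - dim (⨆ k, b k)) := by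
  classical
  -- Replace `b` by `a` one coordinate at a time. Coordinates already replaced make the surroundings
  -- smaller, so by `dim_sup_sub_le` each replacement loses at least what it loses against the full
  -- `b`.
  have key : ∀ S : Finset (Fin (n + 1)),
      ∑ k ∈ S, (dim (⨆ i, b i) - dim (a k ⊔ ⨆ i, b (k.succAbove i)))
        ≤ dim (⨆ i, b i) - dim (⨆ i, if i ∈ S then a i else b i) := by
    intro S
    induction S using Finset.induction_on with
    | empty => simp
    | insert c S hc ih =>
      rw [Finset.sum_insert hc]
      have e1 := iSup_eq_sup_succAbove (fun i => if i ∈ S then a i else b i) c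
      have e2 := iSup_eq_sup_succAbove (fun i => if i ∈ insert c S then a i else b i) c
      simp only [hc, if_false, Finset.mem_insert, true_or, if_true, Fin.succAbove_ne,
        false_or] at e1 e2
      simp only [Finset.mem_insert]
      rw [e1] at ih
      rw [e2, iSup_eq_sup_succAbove b c]
      rw [iSup_eq_sup_succAbove b c] at ih
      have hX : (⨆ i, if c.succAbove i ∈ S then a (c.succAbove i) else b (c.succAbove i))
          ≤ ⨆ i, b (c.succAbove i) := iSup_mono fun i => by
        split_ifs
        · exact hab _
        · exact le_rfl
      have h := dim_sup_sub_le hX (hab c)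
      rw [sup_comm _ (b c), sup_comm _ (a c), sup_comm _ (b c), sup_comm _ (a c)] at h
      linarith
  have h := key Finset.univ
  simp only [Finset.mem_univ, if_true] at h
  -- Modularity converts losses of meets into losses of joins, which `key` controls.
  have e : ∀ k, dim (a k ⊓ ⨆ i, b (k.succAbove i)) - dim (b k ⊓ ⨆ i, b (k.succAbove i))
      = dim (a k) - dim (b k) + (dim (⨆ i, b i) - dim (a k ⊔ ⨆ i, b (k.succAbove i))) := by
    intro k
    have h1 := dim_sup_add_dim_inf (a k) (⨆ i, b (k.succAbove i))
    have h2 := dim_sup_add_dim_inf (b k) (⨆ i, b (k.succAbove i))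
    rw [← iSup_eq_sup_succAbove] at h2
    linarith
  simp only [e, Finset.sum_add_distrib, Finset.sum_sub_distrib] at h ⊢
  linarith

end Rank

/-! ### Averages over independent samples, images of weights, and node updates as mixtures. -/

section Averages

variable {A B : Type*} [Fintype A]

/-- Average of `g` over `n` independent samples from the weight function `v`. -/
noncomputable def avg {n : ℕ} (v : A → ℝ) (g : (Fin n → A) → ℝ) : ℝ :=
  ∑ x : Fin n → A, (∏ k, v (x k)) * g x

/-- The weight function `v` is the image of `p` under `φ`. -/
def IsPush [Fintype B] (p : B → ℝ) (φ : B → A) (v : A → ℝ) : Prop :=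
  ∀ f : A → ℝ, ∑ a, v a * f a = ∑ b, p b * f (φ b)

lemma avg_succAbove {n : ℕ} (v : A → ℝ) (k : Fin (n + 1)) (D : A → (Fin n → A) → ℝ) :
    avg v (fun x => D (x k) (fun i => x (k.succAbove i))) = ∑ a, v a * avg v (D a) := by
  unfold avg
  rw [← (Fin.insertNthEquiv (fun _ => A) k).sum_comp, Fintype.sum_prod_type]
  refine Finset.sum_congr rfl fun a _ => ?_
  rw [Finset.mul_sum]
  refine Finset.sum_congr rfl fun x _ => ?_
  simp [Fin.insertNthEquiv, Fin.prod_univ_succAbove _ k, mul_assoc]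

lemma avg_succ {n : ℕ} (v : A → ℝ) (g : (Fin (n + 1) → A) → ℝ) :
    avg v g = ∑ a, v a * avg v (fun x => g (Fin.cons a x)) := by
  rw [← avg_succAbove v 0 (fun a x => g (Fin.cons a x))]
  congr 1
  funext x
  congr 1
  exact (Fin.cons_self_tail x).symm

lemma avg_zero (v : A → ℝ) (g : (Fin 0 → A) → ℝ) : avg v g = g Fin.elim0 := by
  unfold avg
  rw [Fintype.sum_unique]
  simp only [Finset.univ_eq_empty, Finset.prod_empty, one_mul]
  exact congrArg g (Subsingleton.elim _ _)

lemma avg_push [Fintype B] {p : B → ℝ} {φ : B → A} {v : A → ℝ} (h : IsPush p φ v) {n : ℕ}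
    (g : (Fin n → A) → ℝ) : avg v g = avg p (fun x => g (fun k => φ (x k))) := by
  induction n with
  | zero => rw [avg_zero, avg_zero]; exact congrArg g (Subsingleton.elim _ _)
  | succ n ih =>
    rw [avg_succ, avg_succ, h]
    refine Finset.sum_congr rfl fun b _ => ?_
    rw [ih]
    congr 3
    funext x
    congr 1
    funext k
    refine Fin.cases ?_ (fun i => ?_) k <;> simp

lemma avg_sub {n : ℕ} (v : A → ℝ) (f g : (Fin n → A) → ℝ) :
    avg v (fun x => f x - g x) = avg v f - avg v g := by
  simp [avg, mul_sub]

lemma avg_sum {ι : Type*} (s : Finset ι) {n : ℕ} (v : A → ℝ) (f : ι → (Fin n → A) → ℝ) :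
    avg v (fun x => ∑ i ∈ s, f i x) = ∑ i ∈ s, avg v (f i) := by
  simp only [avg, Finset.mul_sum]
  rw [Finset.sum_comm]

lemma avg_const_mul {n : ℕ} (v : A → ℝ) (c : ℝ) (f : (Fin n → A) → ℝ) :
    avg v (fun x => c * f x) = c * avg v f := by
  simp only [avg, Finset.mul_sum]
  exact Finset.sum_congr rfl fun _ _ => by ring

lemma avg_prod {n : ℕ} (v f : A → ℝ) :
    avg v (fun x : Fin n → A => ∏ k, f (x k)) = (∑ a, v a * f a) ^ n := by
  induction n with
  | zero => simp [avg_zero]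
  | succ n ih =>
    rw [avg_succ, pow_succ', Finset.sum_mul]
    refine Finset.sum_congr rfl fun a _ => ?_
    simp only [Fin.prod_univ_succ, Fin.cons_zero, Fin.cons_succ]
    rw [avg_const_mul, ih, mul_assoc]

lemma avg_one {v : A → ℝ} (hv : ∑ a, v a = 1) {n : ℕ} :
    avg v (fun _ : Fin n → A => (1 : ℝ)) = 1 := by
  have := avg_prod (n := n) v (fun _ => 1)
  simpa [hv] using this

lemma avg_congr {n : ℕ} {v : A → ℝ} {f g : (Fin n → A) → ℝ}
    (h : ∀ x, (∀ k, v (x k) ≠ 0) → f x = g x) : avg v f = avg v g := by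
  refine Finset.sum_congr rfl fun x _ => ?_
  by_cases hx : ∀ k, v (x k) ≠ 0
  · rw [h x hx]
  · push Not at hx
    obtain ⟨k, hk⟩ := hx
    rw [Finset.prod_eq_zero (Finset.mem_univ k) hk, zero_mul, zero_mul]

lemma avg_mono {n : ℕ} {v : A → ℝ} (hv : ∀ a, 0 ≤ v a) {f g : (Fin n → A) → ℝ}
    (h : ∀ x, (∀ k, v (x k) ≠ 0) → f x ≤ g x) : avg v f ≤ avg v g := by
  refine Finset.sum_le_sum fun x _ => ?_
  by_cases hx : ∀ k, v (x k) ≠ 0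
  · exact mul_le_mul_of_nonneg_left (h x hx) (Finset.prod_nonneg fun _ _ => hv _)
  · push Not at hx
    obtain ⟨k, hk⟩ := hx
    rw [Finset.prod_eq_zero (Finset.mem_univ k) hk, zero_mul, zero_mul]

lemma avg_nonneg {n : ℕ} {v : A → ℝ} (hv : ∀ a, 0 ≤ v a) {g : (Fin n → A) → ℝ}
    (h : ∀ x, 0 ≤ g x) : 0 ≤ avg v g :=
  Finset.sum_nonneg fun x _ => mul_nonneg (Finset.prod_nonneg fun _ _ => hv _) (h x)

open Classical in
/-- The unit mass at `a`. -/
noncomputable def dirac {A : Type*} (a b : A) : ℝ := if b = a then 1 else 0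

lemma sum_dirac_mul (a : A) (f : A → ℝ) : ∑ b, dirac a b * f b = f a := by
  classical simp [dirac]

lemma isPush_dirac (a : A) : IsPush (fun _ : Unit => (1 : ℝ)) (fun _ => a) (dirac a) := by
  intro f
  simp [sum_dirac_mul]

lemma avg_dirac {n : ℕ} (a : A) (g : (Fin n → A) → ℝ) : avg (dirac a) g = g fun _ => a := by
  rw [avg_push (isPush_dirac a)]
  simp [avg]

open Classical in
/-- The distribution of the message sent by a node of random type `i` when its incoming messages
are independent samples from `v`. -/
noncomputable def mix {ι : Type*} (I : Finset ι) (c : ι → ℝ) (n : ι → ℕ) (v : A → ℝ)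
    (T : ∀ i, (Fin (n i) → A) → B) (b : B) : ℝ :=
  ∑ i ∈ I, c i * avg v (fun x => if T i x = b then 1 else 0)

section Mix

variable {ι : Type*} {I : Finset ι} {c : ι → ℝ} {n : ι → ℕ} {v : A → ℝ}
  {T : ∀ i, (Fin (n i) → A) → B}

lemma sum_mix_mul [Fintype B] (f : B → ℝ) :
    ∑ b, mix I c n v T b * f b = ∑ i ∈ I, c i * avg v (fun x => f (T i x)) := by
  classical
  simp only [mix, Finset.sum_mul]
  rw [Finset.sum_comm]
  refine Finset.sum_congr rfl fun i _ => ?_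
  simp only [mul_assoc, ← Finset.mul_sum]
  congr 1
  have : ∀ x : Fin (n i) → A, f (T i x) = ∑ b, f b * if T i x = b then 1 else 0 := by
    intro x; simp
  simp only [this]
  rw [avg_sum]
  refine Finset.sum_congr rfl fun b _ => ?_
  rw [avg_const_mul, mul_comm]

lemma sum_mix [Fintype B] (hv : ∑ a, v a = 1) : ∑ b, mix I c n v T b = ∑ i ∈ I, c i := by
  have := sum_mix_mul (I := I) (c := c) (v := v) (T := T) (fun _ => 1)
  simpa [avg_one hv] using this

lemma mix_nonneg (hc : ∀ i ∈ I, 0 ≤ c i) (hv : ∀ a, 0 ≤ v a) (b : B) : 0 ≤ mix I c n v T b :=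
  Finset.sum_nonneg fun i hi => mul_nonneg (hc i hi)
    (avg_nonneg hv fun x => by split_ifs <;> norm_num)

lemma exists_of_mix_ne_zero {b : B} (h : mix I c n v T b ≠ 0) :
    ∃ i ∈ I, c i ≠ 0 ∧ ∃ x, (∀ k, v (x k) ≠ 0) ∧ T i x = b := by
  classical
  obtain ⟨i, hi, h1⟩ := Finset.exists_ne_zero_of_sum_ne_zero h
  obtain ⟨x, -, hx⟩ := Finset.exists_ne_zero_of_sum_ne_zero (right_ne_zero_of_mul h1)
  refine ⟨i, hi, left_ne_zero_of_mul h1, x, fun k hk => ?_, ?_⟩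
  · exact left_ne_zero_of_mul hx (Finset.prod_eq_zero (Finset.mem_univ k) hk)
  · by_contra hT
    exact right_ne_zero_of_mul hx (if_neg hT)

/-- Used with `φ` and `ψ` projections of pairs: a coupling of the inputs of a node induces a
coupling of its outputs. -/
lemma isPush_mix [Fintype B] {A' B' : Type*} [Fintype A'] [Fintype B'] {p : A' → ℝ} {φ : A' → A} {ψ : B' → B}
    {T' : ∀ i, (Fin (n i) → A') → B'} (h : IsPush p φ v)
    (hT : ∀ i x, T i (fun k => φ (x k)) = ψ (T' i x)) :
    IsPush (mix I c n p T') ψ (mix I c n v T) := by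
  intro f
  rw [sum_mix_mul, sum_mix_mul (T := T') (fun b => f (ψ b))]
  refine Finset.sum_congr rfl fun i _ => ?_
  rw [avg_push h]
  simp only [hT]

end Mix

end Averages

/-! ### The two density-evolution updates as mixtures over node types. -/

section Update

variable {F : Type*} [Field F]

/-- Joint weight of an edge label and an independent object. -/
def labelled {A : Type*} (L : Fˣ → ℝ) (z : A → ℝ) (p : Fˣ × A) : ℝ := L p.1 * z p.2

lemma sum_degree_mul (d : DegreeDist) {ι : Type*} (I : Finset ι) (e : ι → ℝ)
    (he : ∑ i ∈ I, e i = 1) : ∑ p ∈ d.coeff.support ×ˢ I, d.coeff p.1 * e p.2 = 1 := by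
  rw [Finset.sum_product]
  simp only [← Finset.mul_sum, he, mul_one]
  exact d.sum_eq_one

variable [Fintype F]

open Classical in
lemma varUpdate_eq_mix {s : ℕ} (lam : DegreeDist) (α : F) (ε : Fin (s + 1) → ℝ)
    (w : AddSubgroup F → ℝ) :
    varUpdate lam α ε w = mix (lam.coeff.support ×ˢ (Finset.univ : Finset (Fin (s + 1))))
      (fun i => lam.coeff i.1 * ε i.2) (fun i => i.1 - 1) w
      (fun i x => vtcMsg (chanSubgroup α i.2) x) := by
  funext H
  unfold mix varUpdate
  rw [Finset.sum_product]
  refine Finset.sum_congr rfl fun i _ => ?_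
  simp only [mul_assoc, ← Finset.mul_sum]
  rfl

variable [DecidableEq F]

lemma sum_labelled {A : Type*} [Fintype A] {L : Fˣ → ℝ} {z : A → ℝ} (hL : ∑ h, L h = 1)
    (hz : ∑ a, z a = 1) : ∑ p, labelled L z p = 1 := by
  simp only [labelled, Fintype.sum_prod_type, ← Finset.mul_sum, hz, mul_one, hL]

lemma isPush_labelled {A B : Type*} [Fintype A] [Fintype B] (L : Fˣ → ℝ) {p : B → ℝ} {φ : B → A}
    {v : A → ℝ} (h : IsPush p φ v) :
    IsPush (labelled L p) (fun x => (x.1, φ x.2)) (labelled L v) := by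
  intro f
  simp only [labelled, Fintype.sum_prod_type, mul_assoc, ← Finset.mul_sum]
  exact Finset.sum_congr rfl fun a _ => by rw [h]

-- The output label belongs to the type of the node, while each input label is paired with its
-- message; the inputs then become i.i.d. samples of pairs.
open Classical in
lemma checkUpdate_eq_mix (rho : DegreeDist) (L : Fˣ → ℝ) (z : AddSubgroup F → ℝ) :
    checkUpdate rho L z = mix (rho.coeff.support ×ˢ (Finset.univ : Finset Fˣ))
      (fun i => rho.coeff i.1 * L i.2) (fun i => i.1 - 1) (labelled L z)
      (fun i x => ctvMsg i.2 (fun k => (x k).1) (fun k => (x k).2)) := by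
  funext H
  unfold mix checkUpdate
  rw [Finset.sum_product]
  refine Finset.sum_congr rfl fun i _ => ?_
  simp only [mul_assoc, ← Finset.mul_sum]
  congr 1
  simp only [avg, checkProb, labelled, Finset.mul_sum]
  rw [Finset.sum_comm]
  refine Finset.sum_congr rfl fun h _ => ?_
  rw [← (Equiv.arrowProdEquivProdArrow (Fin (i - 1)) (fun _ => Fˣ)
    (fun _ => AddSubgroup F)).symm.sum_comp, Fintype.sum_prod_type, Finset.sum_comm]
  refine Finset.sum_congr rfl fun x _ => Finset.sum_congr rfl fun m _ => ?_
  simp only [Equiv.arrowProdEquivProdArrow, Equiv.coe_fn_symm_mk, Finset.prod_mul_distrib]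
  ring_nf
  rfl

end Update

/-! ### Powers of a primitive element as a basis over GF(2). -/

section PowerBasis

lemma closure_eq_span {n : ℕ} {M : Type*} [AddCommGroup M] [Module (ZMod n) M] (S : Set M) :
    AddSubgroup.closure S = (Submodule.span (ZMod n) S).toAddSubgroup := by
  refine le_antisymm ((AddSubgroup.closure_le _).2 Submodule.subset_span) fun x hx => ?_
  have h : Submodule.span (ZMod n) S ≤ AddSubgroup.toZModSubmodule n (AddSubgroup.closure S) :=
    Submodule.span_le.2 AddSubgroup.subset_closure
  exact h hx

variable {F : Type*} [Field F] {s : ℕ} {α : F}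

lemma chanSubgroup_eq (α : F) (j : ℕ) :
    chanSubgroup α j = AddSubgroup.closure ((fun i : ℕ => α ^ i) '' Set.Ico 0 j) := by
  unfold chanSubgroup
  congr 1
  ext x
  simp [eq_comm]

@[simp] lemma chanSubgroup_zero (α : F) : chanSubgroup α 0 = ⊥ := by
  simp [chanSubgroup_eq]

lemma pow_mul_mem_closure {j : ℕ} (t : ℕ) {y : F} (hy : y ∈ chanSubgroup α j) :
    α ^ t * y ∈ AddSubgroup.closure ((fun i : ℕ => α ^ i) '' Set.Ico t (t + j)) := by
  have h : chanSubgroup α j ≤ (AddSubgroup.closure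
      ((fun i : ℕ => α ^ i) '' Set.Ico t (t + j))).comap (AddMonoidHom.mulLeft (α ^ t)) := by
    refine (AddSubgroup.closure_le _).2 ?_
    rintro _ ⟨i, hi, rfl⟩
    refine AddSubgroup.subset_closure ⟨t + i, ⟨by omega, by omega⟩, ?_⟩
    simp [pow_add]
  exact h hy

variable [Fintype F]

/-- Every nonzero element is a power of `α`, so `α` generates the field and its minimal polynomial
has the degree of the extension, which is `s` by counting. -/
lemma linearIndependent_pow_primitive [Algebra (ZMod 2) F] (hF : Fintype.card F = 2 ^ s)
    (hα : IsPrimitiveRoot α (2 ^ s - 1)) :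
    LinearIndependent (ZMod 2) (fun i : Fin s => α ^ (i : ℕ)) := by
  have : NeZero (2 ^ s - 1) := ⟨by
    have := Fintype.one_lt_card (α := F)
    omega⟩
  have htop : IntermediateField.adjoin (ZMod 2) {α} = ⊤ := by
    rw [eq_top_iff]
    rintro x -
    by_cases hx : x = 0
    · rw [hx]; exact zero_mem _
    · have h1 := FiniteField.pow_card_sub_one_eq_one x hx
      rw [hF] at h1
      obtain ⟨i, -, rfl⟩ := hα.eq_pow_of_pow_eq_one h1
      exact pow_mem (IntermediateField.mem_adjoin_simple_self _ _) _
  have h2 := (Field.primitive_element_iff_minpoly_natDegree_eq (ZMod 2) α).1 htop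
  have h3 := Module.card_eq_pow_finrank (K := ZMod 2) (V := F)
  rw [hF, ZMod.card] at h3
  have h4 := Nat.pow_right_injective le_rfl h3
  have h5 := linearIndependent_pow (K := ZMod 2) α
  rw [h2, ← h4] at h5
  exact h5

lemma exists_algebra (hF : Fintype.card F = 2 ^ s) : Nonempty (Algebra (ZMod 2) F) := by
  have : CharP F 2 := charP_of_card_eq_prime_pow hF
  exact ⟨ZMod.algebra F 2⟩

/-- Disjoint parts of a basis span independent subspaces; the bound `i < s` keeps the exponents
inside the basis. -/
lemma closure_pow_inf_eq_bot (hF : Fintype.card F = 2 ^ s) (hα : IsPrimitiveRoot α (2 ^ s - 1))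
    {S T : Set ℕ} (hST : Disjoint S T) (hS : ∀ i ∈ S, i < s) (hT : ∀ i ∈ T, i < s) {x : F}
    (hxS : x ∈ AddSubgroup.closure ((fun i : ℕ => α ^ i) '' S))
    (hxT : x ∈ AddSubgroup.closure ((fun i : ℕ => α ^ i) '' T)) : x = 0 := by
  obtain ⟨_⟩ := exists_algebra hF
  have hli := linearIndependent_pow_primitive hF hα
  have e : ∀ U : Set ℕ, (∀ i ∈ U, i < s) → (fun i : ℕ => α ^ i) '' U
      = (fun i : Fin s => α ^ (i : ℕ)) '' {i : Fin s | (i : ℕ) ∈ U} := by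
    intro U hU
    ext y
    constructor
    · rintro ⟨i, hi, rfl⟩
      exact ⟨⟨i, hU i hi⟩, hi, rfl⟩
    · rintro ⟨i, hi, rfl⟩
      exact ⟨i, hi, rfl⟩
  rw [closure_eq_span (n := 2), e S hS] at hxS
  rw [closure_eq_span (n := 2), e T hT] at hxT
  have hd : Disjoint {i : Fin s | (i : ℕ) ∈ S} {i : Fin s | (i : ℕ) ∈ T} :=
    Set.disjoint_left.2 fun i h1 h2 => Set.disjoint_left.1 hST h1 h2
  exact (Submodule.disjoint_def.1 (hli.disjoint_span_image hd)) x hxS hxT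

lemma dim_chanSubgroup (hF : Fintype.card F = 2 ^ s) (hα : IsPrimitiveRoot α (2 ^ s - 1))
    {j : ℕ} (hj : j ≤ s) : dim (chanSubgroup α j) = j := by
  obtain ⟨_⟩ := exists_algebra hF
  have hli := (linearIndependent_pow_primitive hF hα).comp _ (Fin.castLE_injective hj)
  have h1 := finrank_span_eq_card hli
  have e : (fun i : ℕ => α ^ i) '' Set.Ico 0 j
      = Set.range ((fun i : Fin s => α ^ (i : ℕ)) ∘ Fin.castLE hj) := by
    ext y
    constructor
    · rintro ⟨i, hi, rfl⟩
      exact ⟨⟨i, hi.2⟩, rfl⟩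
    · rintro ⟨i, rfl⟩
      exact ⟨i, ⟨Nat.zero_le _, i.2⟩, rfl⟩
  have h2 : Nat.card (chanSubgroup α j) = 2 ^ j := by
    rw [chanSubgroup_eq, closure_eq_span (n := 2), e]
    have := Module.natCard_eq_pow_finrank (K := ZMod 2)
      (V := Submodule.span (ZMod 2) (Set.range ((fun i : Fin s => α ^ (i : ℕ)) ∘ Fin.castLE hj)))
    rw [h1] at this
    simpa using this
  simp [dim, h2, Real.logb_pow]

lemma dim_top (hF : Fintype.card F = 2 ^ s) : dim (⊤ : AddSubgroup F) = s := by
  simp [dim, Nat.card_eq_fintype_card, hF, Real.logb_pow]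

end PowerBasis

/-! ### Optimal labels and the independence of the blocks they produce. -/

section Labels

variable {F : Type*} [Field F] {s j : ℕ} {α : F}

lemma chanSubgroup_ne_bot (hj : 0 < j) : chanSubgroup α j ≠ ⊥ := by
  intro h
  have h1 : (1 : F) ∈ chanSubgroup α j := AddSubgroup.subset_closure ⟨0, hj, by simp⟩
  rw [h, AddSubgroup.mem_bot] at h1
  exact one_ne_zero h1

/-- A check node passes on all of `M_0^j` if an input equal to it has the label of the output
edge. -/
lemma chanSubgroup_le_ctvMsg {n : ℕ} {hout : Fˣ} {hin : Fin n → Fˣ} {m : Fin n → AddSubgroup F}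
    {k : Fin n} (hk : hin k = hout) (hm : m k = chanSubgroup α j) :
    chanSubgroup α j ≤ ctvMsg hout hin m := by
  refine le_trans ?_ (le_iSup _ k)
  rw [hk, hm]
  intro x hx
  exact ⟨x, hx, by simp⟩

variable [Fintype F]

lemma pos_of_card (hF : Fintype.card F = 2 ^ s) : 0 < s := by
  rcases Nat.eq_zero_or_pos s with rfl | h
  · have := Fintype.one_lt_card (α := F)
    simp [hF] at this
  · exact h

variable [DecidableEq F]

lemma card_optLabelSet (hF : Fintype.card F = 2 ^ s) (hα : IsPrimitiveRoot α (2 ^ s - 1))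
    (hj : j ∣ s) : (optLabelSet α s j).card = s / j := by
  have hs := pos_of_card hF
  have hj0 := Nat.pos_of_dvd_of_pos hj hs
  have hα0 : α ≠ 0 := by
    rintro rfl
    have h0 : 2 ^ s - 1 ≠ 0 := by
      have := Nat.lt_two_pow_self (n := s)
      omega
    have := hα.pow_eq_one
    rw [zero_pow h0] at this
    exact zero_ne_one this
  -- Exponents below the order of `α` give distinct powers, so no two values of `t` give the same
  -- label.
  have hlt : ∀ t < s / j, t * j < 2 ^ s - 1 := by
    intro t ht
    have h1 : (t + 1) * j ≤ s := (Nat.mul_le_mul_right j ht).trans (Nat.div_mul_le_self s j)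
    have := Nat.lt_two_pow_self (n := s)
    rw [Nat.add_mul] at h1
    omega
  rw [← Finset.card_range (s / j)]
  symm
  refine Finset.card_bij (fun t _ => (Units.mk0 α hα0) ^ (t * j)) ?_ ?_ ?_
  · intro t ht
    simp only [optLabelSet, Finset.mem_filter, Finset.mem_univ, true_and]
    exact ⟨t, Finset.mem_range.1 ht, by simp⟩
  · intro t ht t' ht' h
    have h1 := congrArg (Units.val) h
    simp only [Units.val_pow_eq_pow_val, Units.val_mk0] at h1
    exact Nat.eq_of_mul_eq_mul_right hj0
      (hα.pow_inj (hlt _ (Finset.mem_range.1 ht)) (hlt _ (Finset.mem_range.1 ht')) h1)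
  · intro h hh
    simp only [optLabelSet, Finset.mem_filter, Finset.mem_univ, true_and] at hh
    obtain ⟨t, ht, e⟩ := hh
    exact ⟨t, Finset.mem_range.2 ht, Units.ext (by simp [e])⟩

lemma optLabels_mem_stdSimplex (hF : Fintype.card F = 2 ^ s)
    (hα : IsPrimitiveRoot α (2 ^ s - 1)) (hj : j ∣ s) : optLabels α s j ∈ stdSimplex ℝ Fˣ := by
  have hc := card_optLabelSet hF hα hj
  have hpos : 0 < s / j :=
    Nat.div_pos (Nat.le_of_dvd (pos_of_card hF) hj) (Nat.pos_of_dvd_of_pos hj (pos_of_card hF))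
  refine ⟨fun h => ?_, ?_⟩
  · unfold optLabels
    split_ifs
    · positivity
    · exact le_rfl
  · simp only [optLabels]
    rw [Finset.sum_ite_mem, Finset.univ_inter, Finset.sum_const, nsmul_eq_mul, mul_inv_cancel₀]
    rw [hc]
    exact_mod_cast hpos.ne'

/-- With optimal labels and inputs in `{⊥, M_0^j}`, a check node passes on nothing of `M_0^j` if no
input equal to it has the label of the output edge. -/
lemma chanSubgroup_inf_ctvMsg (hF : Fintype.card F = 2 ^ s) (hα : IsPrimitiveRoot α (2 ^ s - 1))
    {n : ℕ} {hout : Fˣ} {hin : Fin n → Fˣ} {m : Fin n → AddSubgroup F}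
    (ho : hout ∈ optLabelSet α s j) (hi : ∀ k, hin k ∈ optLabelSet α s j)
    (hm : ∀ k, m k = ⊥ ∨ m k = chanSubgroup α j)
    (hne : ∀ k, hin k = hout → m k ≠ chanSubgroup α j) :
    chanSubgroup α j ⊓ ctvMsg hout hin m = ⊥ := by
  simp only [optLabelSet, Finset.mem_filter, Finset.mem_univ, true_and] at ho hi
  obtain ⟨t, ht, hout_eq⟩ := ho
  have hle : ∀ u < s / j, u * j + j ≤ s := fun u hu => by
    have h1 : (u + 1) * j ≤ s := (Nat.mul_le_mul_right j hu).trans (Nat.div_mul_le_self s j)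
    rwa [Nat.add_mul, one_mul] at h1
  -- Pulling back along multiplication by `hout` removes the division by the output label: the
  -- inputs then occupy only basis exponents outside block `t`.
  have hctv : ctvMsg hout hin m ≤ (AddSubgroup.closure ((fun i : ℕ => α ^ i) ''
      {i | i < s ∧ i ∉ Set.Ico (t * j) (t * j + j)})).comap
        (AddMonoidHom.mulLeft (hout : F)) := by
    refine iSup_le fun k => ?_
    rw [AddSubgroup.map_le_iff_le_comap]
    intro y hy
    rcases hm k with h0 | h1
    · rw [h0, AddSubgroup.mem_bot] at hy
      rw [hy]
      exact zero_mem _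
    · obtain ⟨u, hu, hin_eq⟩ := hi k
      have hut : u ≠ t := by
        rintro rfl
        exact hne k (Units.ext (hin_eq.trans hout_eq.symm)) h1
      rw [h1] at hy
      have hmem := pow_mul_mem_closure (u * j) hy
      have e : (hout : F) * (((hin k : F) / (hout : F)) * y) = α ^ (u * j) * y := by
        rw [← mul_assoc, mul_div_cancel₀ _ hout.ne_zero, hin_eq]
      simp only [AddSubgroup.mem_comap, AddMonoidHom.coe_mulLeft]
      rw [e]
      refine AddSubgroup.closure_mono (Set.image_mono ?_) hmem
      rintro i ⟨h2, h3⟩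
      refine ⟨h3.trans_le (hle u hu), fun h4 => ?_⟩
      rcases lt_or_gt_of_ne hut with h | h
      · have := Nat.mul_le_mul_right j (Nat.succ_le_of_lt h)
        rw [Nat.succ_mul] at this
        exact absurd h4.1 (by omega)
      · have := Nat.mul_le_mul_right j (Nat.succ_le_of_lt h)
        rw [Nat.succ_mul] at this
        exact absurd h4.2 (by omega)
  rw [eq_bot_iff]
  rintro x ⟨hx1, hx2⟩
  rw [AddSubgroup.mem_bot]
  have h1 := pow_mul_mem_closure (t * j) hx1
  rw [← hout_eq] at h1
  have h0 : (hout : F) * x = 0 := by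
    refine closure_pow_inf_eq_bot hF hα ?_ ?_ ?_ h1 (hctv hx2)
    · exact Set.disjoint_left.2 fun i h2 h3 => h3.2 h2
    · exact fun i h2 => h2.2.trans_le (hle t ht)
    · exact fun i h2 => h2.1
  exact (mul_eq_zero.1 h0).resolve_left hout.ne_zero

end Labels

/-! ### Channels with one nonzero erasure type. -/

section Single

variable {s j : ℕ}

lemma sum_single_mul (h1 : 0 < j) (h2 : j ≤ s) (x : ℝ) (f : ℕ → ℝ) :
    ∑ i : Fin (s + 1), single s j x i * f i = x * f j + (1 - x) * f 0 := by
  have e : ∀ i : Fin (s + 1), single s j x i * f i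
      = (if i = ⟨j, by omega⟩ then x * f i else 0) + (if i = 0 then (1 - x) * f i else 0) := by
    intro i
    simp only [single, Fin.ext_iff, Fin.val_zero]
    rcases eq_or_ne (i : ℕ) j with h | h
    · rw [if_pos h, if_pos h, if_neg (by omega), add_zero]
    · rw [if_neg h, if_neg h, zero_add, ite_mul, zero_mul]
  simp only [e, Finset.sum_add_distrib, Finset.sum_ite_eq', Finset.mem_univ, if_true, Fin.val_zero]

lemma single_mem_stdSimplex (h1 : 0 < j) (h2 : j ≤ s) {x : ℝ} (hx : x ∈ Set.Icc (0 : ℝ) 1) :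
    single s j x ∈ stdSimplex ℝ (Fin (s + 1)) := by
  refine ⟨fun i => ?_, ?_⟩
  · unfold single
    split_ifs
    · exact hx.1
    · linarith [hx.2]
    · exact le_rfl
  · simpa using sum_single_mul h1 h2 x fun _ => 1

end Single

/-! ### Density evolution preserves probability distributions. -/

section Distribution

variable {F : Type*} [Field F] [Fintype F] {s : ℕ} {lam rho : DegreeDist} {α : F}
  {L : Fˣ → ℝ} {ε : Fin (s + 1) → ℝ}

lemma varUpdate_mem_stdSimplex (hε : ε ∈ stdSimplex ℝ (Fin (s + 1))) {w : AddSubgroup F → ℝ}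
    (hw : w ∈ stdSimplex ℝ (AddSubgroup F)) :
    varUpdate lam α ε w ∈ stdSimplex ℝ (AddSubgroup F) := by
  rw [varUpdate_eq_mix]
  refine ⟨mix_nonneg (fun i _ => mul_nonneg (lam.nonneg _) (hε.1 _)) hw.1, ?_⟩
  rw [sum_mix hw.2]
  exact sum_degree_mul _ _ _ hε.2

variable [DecidableEq F]

lemma checkUpdate_mem_stdSimplex (hL : L ∈ stdSimplex ℝ Fˣ) {z : AddSubgroup F → ℝ}
    (hz : z ∈ stdSimplex ℝ (AddSubgroup F)) :
    checkUpdate rho L z ∈ stdSimplex ℝ (AddSubgroup F) := by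
  rw [checkUpdate_eq_mix]
  refine ⟨mix_nonneg (fun i _ => mul_nonneg (rho.nonneg _) (hL.1 _))
    (fun p => mul_nonneg (hL.1 _) (hz.1 _)), ?_⟩
  rw [sum_mix (sum_labelled hL.2 hz.2)]
  exact sum_degree_mul _ _ _ hL.2

open Classical in
lemma sum_vtcProb_zero_mul (f : AddSubgroup F → ℝ) :
    ∑ H, vtcProb lam rho α L ε 0 H * f H = ∑ i, ε i * f (chanSubgroup α i) := by
  simp only [vtcProb, Finset.sum_mul]
  rw [Finset.sum_comm]
  simp [ite_mul]

open Classical in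
lemma vtcProb_mem_stdSimplex (hL : L ∈ stdSimplex ℝ Fˣ) (hε : ε ∈ stdSimplex ℝ (Fin (s + 1)))
    (l : ℕ) : vtcProb lam rho α L ε l ∈ stdSimplex ℝ (AddSubgroup F) := by
  induction l with
  | zero =>
    refine ⟨fun H => Finset.sum_nonneg fun i _ => ?_, ?_⟩
    · split_ifs
      · exact hε.1 i
      · exact le_rfl
    · have := sum_vtcProb_zero_mul (lam := lam) (rho := rho) (α := α) (L := L) (ε := ε) fun _ => 1
      simpa [hε.2] using this
  | succ l ih => exact varUpdate_mem_stdSimplex hε (checkUpdate_mem_stdSimplex hL ih)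

open Classical in
lemma errorProb_eq (hL : L ∈ stdSimplex ℝ Fˣ) (hε : ε ∈ stdSimplex ℝ (Fin (s + 1))) (l : ℕ) :
    errorProb lam rho α L ε l = 1 - vtcProb lam rho α L ε l ⊥ := by
  have h := (vtcProb_mem_stdSimplex (lam := lam) (rho := rho) (α := α) hL hε l).2
  have e : ∀ H : AddSubgroup F, (if H ≠ ⊥ then vtcProb lam rho α L ε l H else 0)
      = vtcProb lam rho α L ε l H - (if H = ⊥ then vtcProb lam rho α L ε l H else 0) := by
    intro H
    by_cases hH : H = ⊥ <;> simp [hH]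
  rw [errorProb, Finset.sum_filter, Finset.sum_congr rfl fun H _ => e H, Finset.sum_sub_distrib, h,
    Finset.sum_ite_eq', if_pos (Finset.mem_univ _)]

end Distribution

/-! ### Reduction of density evolution under the optimal labels to a scalar recursion. -/

section Reduction

variable {F : Type*} [Field F] [Fintype F] {s j : ℕ} {α : F}

lemma eq_zero_or_eq_of_single_ne_zero {x : ℝ} {i : Fin (s + 1)} (h : single s j x i ≠ 0) :
    (i : ℕ) = j ∨ (i : ℕ) = 0 := by
  by_contra hn
  push Not at hn
  exact h (by simp [single, hn.1, hn.2])

-- The channel must give `M_0^j`, not `⊥`, and the intersection is then all of it exactly when every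
-- incoming message contains it. Independence turns this into a power, hence into `lam.eval`.
open Classical in
lemma varUpdate_single (h1 : 0 < j) (h2 : j ≤ s) (lam : DegreeDist) (x : ℝ)
    (w : AddSubgroup F → ℝ) :
    varUpdate lam α (single s j x) w (chanSubgroup α j)
      = x * lam.eval (∑ W, w W * (if chanSubgroup α j ≤ W then 1 else 0)) := by
  rw [varUpdate_eq_mix]
  unfold mix
  rw [Finset.sum_product]
  simp only [mul_assoc, ← Finset.mul_sum]
  unfold DegreeDist.eval
  rw [Finset.mul_sum]
  refine Finset.sum_congr rfl fun i _ => ?_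
  rw [sum_single_mul h1 h2 x (fun t => avg w (fun y : Fin (i - 1) → AddSubgroup F =>
    if vtcMsg (chanSubgroup α t) y = chanSubgroup α j then 1 else 0))]
  have e0 : ∀ y : Fin (i - 1) → AddSubgroup F,
      ¬ vtcMsg (chanSubgroup α 0) y = chanSubgroup α j := by
    intro y h
    rw [chanSubgroup_zero, vtcMsg, bot_inf_eq] at h
    exact chanSubgroup_ne_bot h1 h.symm
  have e1 : ∀ y : Fin (i - 1) → AddSubgroup F,
      (if vtcMsg (chanSubgroup α j) y = chanSubgroup α j then (1 : ℝ) else 0)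
        = ∏ k, if chanSubgroup α j ≤ y k then (1 : ℝ) else 0 := by
    intro y
    rw [Finset.prod_boole]
    simp [vtcMsg]
  simp only [e0, if_false, e1]
  rw [avg_prod w (fun W => if chanSubgroup α j ≤ W then (1 : ℝ) else 0)]
  simp [avg]
  ring

/-- Check messages need not lie in `{⊥, M_0^j}`; it suffices that each contains `M_0^j` or meets it
trivially. -/
lemma eq_bot_or_eq_of_varUpdate_ne_zero {lam : DegreeDist} {x : ℝ} {w : AddSubgroup F → ℝ}
    (hw : ∀ W, w W ≠ 0 → chanSubgroup α j ≤ W ∨ chanSubgroup α j ⊓ W = ⊥) {H : AddSubgroup F}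
    (hH : varUpdate lam α (single s j x) w H ≠ 0) : H = ⊥ ∨ H = chanSubgroup α j := by
  rw [varUpdate_eq_mix] at hH
  obtain ⟨i, _, hi, y, hy, rfl⟩ := exists_of_mix_ne_zero hH
  rcases eq_zero_or_eq_of_single_ne_zero (right_ne_zero_of_mul hi) with h | h
  · rw [h]
    by_cases hk : ∀ k, chanSubgroup α j ≤ y k
    · exact Or.inr (inf_eq_left.2 (le_iInf hk))
    · push Not at hk
      obtain ⟨k, hk⟩ := hk
      left
      rw [eq_bot_iff, ← (hw _ (hy k)).resolve_left hk]
      exact inf_le_inf_left _ (iInf_le _ _)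
  · rw [h, chanSubgroup_zero, vtcMsg, bot_inf_eq]
    exact Or.inl rfl

variable [DecidableEq F]

lemma natCast_div_inv (hj : j ∣ s) : (((s / j : ℕ) : ℝ))⁻¹ = j / s := by
  rcases eq_or_ne j 0 with rfl | h
  · simp
  · rw [Nat.cast_div hj (by exact_mod_cast h), inv_div]

lemma mem_optLabelSet_of_ne_zero {h : Fˣ} (hh : optLabels α s j h ≠ 0) :
    h ∈ optLabelSet α s j := by
  by_contra hn
  exact hh (if_neg hn)

open Classical in
lemma sum_checkUpdate_pass (hF : Fintype.card F = 2 ^ s) (hα : IsPrimitiveRoot α (2 ^ s - 1))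
    (hj : j ∣ s) (rho : DegreeDist) {z : AddSubgroup F → ℝ}
    (hz : z ∈ stdSimplex ℝ (AddSubgroup F))
    (hsupp : ∀ H, z H ≠ 0 → H = ⊥ ∨ H = chanSubgroup α j) :
    ∑ W, checkUpdate rho (optLabels α s j) z W * (if chanSubgroup α j ≤ W then 1 else 0)
      = 1 - rho.eval (1 - z (chanSubgroup α j) * j / s) := by
  have hL := optLabels_mem_stdSimplex hF hα hj
  have hj0 := Nat.pos_of_dvd_of_pos hj (pos_of_card hF)
  set M := chanSubgroup α j with hM
  have h1 := (checkUpdate_mem_stdSimplex (rho := rho) hL hz).2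
  -- The complementary event factorises: `M` is blocked exactly when no input is the pair (output
  -- label, `M`), and each input avoids that pair with probability `1 - z M * j / s`.
  have h2 : ∑ W, checkUpdate rho (optLabels α s j) z W * (if M ≤ W then 0 else 1)
      = rho.eval (1 - z M * j / s) := by
    rw [checkUpdate_eq_mix, sum_mix_mul]
    have key : ∀ i ∈ rho.coeff.support ×ˢ (Finset.univ : Finset Fˣ),
        rho.coeff i.1 * optLabels α s j i.2 * avg (labelled (optLabels α s j) z)
          (fun x : Fin (i.1 - 1) → Fˣ × AddSubgroup F =>
            if M ≤ ctvMsg i.2 (fun k => (x k).1) (fun k => (x k).2) then (0 : ℝ) else 1)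
        = rho.coeff i.1 * (1 - z M * j / s) ^ (i.1 - 1) * optLabels α s j i.2 := by
      intro i _
      by_cases hi : optLabels α s j i.2 = 0
      · rw [hi]; ring
      have e : avg (labelled (optLabels α s j) z)
          (fun x : Fin (i.1 - 1) → Fˣ × AddSubgroup F =>
            if M ≤ ctvMsg i.2 (fun k => (x k).1) (fun k => (x k).2) then (0 : ℝ) else 1)
          = avg (labelled (optLabels α s j) z) (fun x : Fin (i.1 - 1) → Fˣ × AddSubgroup F =>
            ∏ k, if x k = (i.2, M) then (0 : ℝ) else 1) := by
        refine avg_congr fun x hx => ?_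
        by_cases hk : ∃ k, x k = (i.2, M)
        · obtain ⟨k, hk⟩ := hk
          rw [if_pos (chanSubgroup_le_ctvMsg (k := k) (by rw [hk]) (by rw [hk]))]
          exact (Finset.prod_eq_zero (f := fun k => if x k = (i.2, M) then (0 : ℝ) else 1)
            (Finset.mem_univ k) (if_pos hk)).symm
        · push Not at hk
          rw [Finset.prod_eq_one fun k _ => if_neg (hk k), if_neg]
          intro hle
          have h0 : M ⊓ ctvMsg i.2 (fun k => (x k).1) (fun k => (x k).2) = ⊥ :=
            chanSubgroup_inf_ctvMsg hF hα (mem_optLabelSet_of_ne_zero hi)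
              (fun k => mem_optLabelSet_of_ne_zero (left_ne_zero_of_mul (hx k)))
              (fun k => hsupp _ (right_ne_zero_of_mul (hx k)))
              (fun k h3 h4 => hk k (Prod.ext h3 h4))
          rw [inf_eq_left.2 hle] at h0
          exact chanSubgroup_ne_bot hj0 h0
      have e2 : ∑ p, labelled (optLabels α s j) z p * (if p = (i.2, M) then (0 : ℝ) else 1)
          = 1 - z M * j / s := by
        have h3 : ∀ p, labelled (optLabels α s j) z p * (if p = (i.2, M) then (0 : ℝ) else 1)
            = labelled (optLabels α s j) z p
              - (if p = (i.2, M) then labelled (optLabels α s j) z p else 0) := by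
          intro p; split_ifs <;> ring
        simp only [h3, Finset.sum_sub_distrib, sum_labelled hL.2 hz.2, Finset.sum_ite_eq',
          Finset.mem_univ, if_true]
        simp only [labelled, optLabels, if_pos (mem_optLabelSet_of_ne_zero hi),
          card_optLabelSet hF hα hj, natCast_div_inv hj]
        ring
      rw [e, avg_prod _ (fun p => if p = (i.2, M) then (0 : ℝ) else 1), e2]
      ring
    rw [Finset.sum_congr rfl key, Finset.sum_product]
    simp only [← Finset.mul_sum, hL.2, mul_one]
    rfl
  refine Eq.trans ?_ (congrArg₂ (· - ·) h1 h2)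
  rw [← Finset.sum_sub_distrib]
  refine Finset.sum_congr rfl fun W _ => ?_
  split_ifs <;> ring

lemma inf_eq_bot_of_checkUpdate_ne_zero (hF : Fintype.card F = 2 ^ s) (hα : IsPrimitiveRoot α (2 ^ s - 1))
    {rho : DegreeDist} {z : AddSubgroup F → ℝ}
    (hsupp : ∀ H, z H ≠ 0 → H = ⊥ ∨ H = chanSubgroup α j) {W : AddSubgroup F}
    (hW : checkUpdate rho (optLabels α s j) z W ≠ 0) :
    chanSubgroup α j ≤ W ∨ chanSubgroup α j ⊓ W = ⊥ := by
  rw [checkUpdate_eq_mix] at hW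
  obtain ⟨i, _, hi, x, hx, rfl⟩ := exists_of_mix_ne_zero hW
  by_cases hk : ∃ k, x k = (i.2, chanSubgroup α j)
  · obtain ⟨k, hk⟩ := hk
    exact Or.inl (chanSubgroup_le_ctvMsg (k := k) (by rw [hk]) (by rw [hk]))
  · push Not at hk
    exact Or.inr (chanSubgroup_inf_ctvMsg hF hα (mem_optLabelSet_of_ne_zero
      (right_ne_zero_of_mul hi))
      (fun k => mem_optLabelSet_of_ne_zero (left_ne_zero_of_mul (hx k)))
      (fun k => hsupp _ (right_ne_zero_of_mul (hx k)))
      (fun k h3 h4 => hk k (Prod.ext h3 h4)))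

/-- The scalar density-evolution recursion, where `c` is the probability that two labels agree. -/
noncomputable def scalarDE (lam rho : DegreeDist) (c ε : ℝ) : ℕ → ℝ
  | 0 => ε
  | l + 1 => ε * lam.eval (1 - rho.eval (1 - scalarDE lam rho c ε l * c))

lemma scalarDE_mul (lam rho : DegreeDist) (c ε : ℝ) (l : ℕ) :
    scalarDE lam rho c ε l * c = bec lam rho (ε * c) l := by
  induction l with
  | zero => rfl
  | succ l ih => rw [scalarDE, bec, ih]; ring

-- The two claims go through one induction: the recursion for the probability is valid only while
-- the messages are supported on `{⊥, M_0^j}`.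
open Classical in
lemma vtcProb_optLabels (hF : Fintype.card F = 2 ^ s) (hα : IsPrimitiveRoot α (2 ^ s - 1))
    (hj : j ∣ s) (lam rho : DegreeDist) {ε : ℝ} (hε : ε ∈ Set.Icc (0 : ℝ) 1) (l : ℕ) :
    vtcProb lam rho α (optLabels α s j) (single s j ε) l (chanSubgroup α j)
        = scalarDE lam rho (j / s) ε l ∧
      ∀ H, vtcProb lam rho α (optLabels α s j) (single s j ε) l H ≠ 0 →
        H = ⊥ ∨ H = chanSubgroup α j := by
  have hL := optLabels_mem_stdSimplex hF hα hj
  have hs := pos_of_card hF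
  have hj0 := Nat.pos_of_dvd_of_pos hj hs
  have hjs := Nat.le_of_dvd hs hj
  induction l with
  | zero =>
    have e : ∀ H, vtcProb lam rho α (optLabels α s j) (single s j ε) 0 H
        = ε * (if chanSubgroup α j = H then 1 else 0)
          + (1 - ε) * (if chanSubgroup α 0 = H then 1 else 0) := by
      intro H
      rw [← sum_single_mul hj0 hjs ε (fun t => if chanSubgroup α t = H then 1 else 0)]
      simp [vtcProb]
    constructor
    · rw [e, chanSubgroup_zero, if_pos rfl, if_neg (chanSubgroup_ne_bot hj0).symm, scalarDE]
      ring
    · intro H hH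
      rw [e, chanSubgroup_zero] at hH
      by_contra hn
      push Not at hn
      rw [if_neg hn.1.symm, if_neg hn.2.symm] at hH
      simp at hH
  | succ l ih =>
    refine ⟨?_, fun H hH => eq_bot_or_eq_of_varUpdate_ne_zero
      (fun W hW => inf_eq_bot_of_checkUpdate_ne_zero hF hα ih.2 hW) hH⟩
    have hz := vtcProb_mem_stdSimplex (lam := lam) (rho := rho) (α := α) hL
      (single_mem_stdSimplex hj0 hjs hε) l
    have h := sum_checkUpdate_pass hF hα hj rho hz ih.2
    rw [vtcProb, varUpdate_single hj0 hjs, h, ih.1, scalarDE, mul_div_assoc]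

open Classical in
lemma vtcProb_optLabels_bot (hF : Fintype.card F = 2 ^ s) (hα : IsPrimitiveRoot α (2 ^ s - 1))
    (hj : j ∣ s) (lam rho : DegreeDist) {ε : ℝ} (hε : ε ∈ Set.Icc (0 : ℝ) 1) (l : ℕ) :
    vtcProb lam rho α (optLabels α s j) (single s j ε) l ⊥
      = 1 - scalarDE lam rho (j / s) ε l := by
  have hL := optLabels_mem_stdSimplex hF hα hj
  have hs := pos_of_card hF
  have hj0 := Nat.pos_of_dvd_of_pos hj hs
  have hz := vtcProb_mem_stdSimplex (lam := lam) (rho := rho) (α := α) hL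
    (single_mem_stdSimplex hj0 (Nat.le_of_dvd hs hj) hε) l
  obtain ⟨h1, h2⟩ := vtcProb_optLabels hF hα hj lam rho hε l
  have h3 := hz.2
  rw [Finset.sum_eq_add (chanSubgroup α j) ⊥ (chanSubgroup_ne_bot hj0)
    (fun H _ hH => by
      by_contra h4
      rcases h2 H h4 with h | h
      · exact hH.2 h
      · exact hH.1 h) (by simp) (by simp), h1] at h3
  linarith

lemma errorProb_optLabels (hF : Fintype.card F = 2 ^ s) (hα : IsPrimitiveRoot α (2 ^ s - 1))
    (hj : j ∣ s) (lam rho : DegreeDist) {ε : ℝ} (hε : ε ∈ Set.Icc (0 : ℝ) 1) (l : ℕ) :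
    errorProb lam rho α (optLabels α s j) (single s j ε) l = scalarDE lam rho (j / s) ε l := by
  have hs := pos_of_card hF
  rw [errorProb_eq (optLabels_mem_stdSimplex hF hα hj) (single_mem_stdSimplex
    (Nat.pos_of_dvd_of_pos hj hs) (Nat.le_of_dvd hs hj) hε),
    vtcProb_optLabels_bot hF hα hj lam rho hε]
  ring

lemma single_mem_labelRegion_iff (hF : Fintype.card F = 2 ^ s) (hα : IsPrimitiveRoot α (2 ^ s - 1))
    (hj : j ∣ s) (lam rho : DegreeDist) {ε : ℝ} (hε : ε ∈ Set.Icc (0 : ℝ) 1) :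
    single s j ε ∈ labelRegion s lam rho α (optLabels α s j) ↔
      Tendsto (bec lam rho (ε * j / s)) atTop (𝓝 0) := by
  have hs := pos_of_card hF
  have hj0 := Nat.pos_of_dvd_of_pos hj hs
  have hc : (j / s : ℝ) ≠ 0 := by positivity
  have e : errorProb lam rho α (optLabels α s j) (single s j ε)
      = fun l => bec lam rho (ε * j / s) l * (j / s : ℝ)⁻¹ := by
    funext l
    rw [errorProb_optLabels hF hα hj lam rho hε, mul_div_assoc, ← scalarDE_mul,
      mul_inv_cancel_right₀ hc]
  have e2 : bec lam rho (ε * j / s) = fun l =>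
      errorProb lam rho α (optLabels α s j) (single s j ε) l * (j / s : ℝ) := by
    funext l
    rw [e, inv_mul_cancel_right₀ hc]
  refine ⟨fun h => ?_, fun h => ⟨single_mem_stdSimplex hj0 (Nat.le_of_dvd hs hj) hε, ?_⟩⟩
  · rw [e2]
    simpa using h.2.mul_const (j / s : ℝ)
  · rw [e]
    simpa using h.mul_const (j / s : ℝ)⁻¹

end Reduction

/-! ### Monotonicity of the BEC recursion and rescaling of thresholds. -/

section Threshold

namespace DegreeDist

variable (d : DegreeDist)

lemma eval_one : d.eval 1 = 1 := by simpa [eval] using d.sum_eq_one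

lemma eval_zero : d.eval 0 = 0 := by
  refine Finset.sum_eq_zero fun i hi => ?_
  have := d.two_le i hi
  rw [zero_pow (by omega), mul_zero]

lemma eval_mono {x y : ℝ} (hx : 0 ≤ x) (hxy : x ≤ y) : d.eval x ≤ d.eval y :=
  Finset.sum_le_sum fun i _ => mul_le_mul_of_nonneg_left (pow_le_pow_left₀ hx hxy _) (d.nonneg i)

lemma eval_mem_Icc {x : ℝ} (hx : x ∈ Set.Icc (0 : ℝ) 1) : d.eval x ∈ Set.Icc (0 : ℝ) 1 :=
  ⟨d.eval_zero ▸ d.eval_mono le_rfl hx.1, d.eval_one ▸ d.eval_mono hx.1 hx.2⟩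

end DegreeDist

lemma one_sub_mem_Icc {x : ℝ} (hx : x ∈ Set.Icc (0 : ℝ) 1) : 1 - x ∈ Set.Icc (0 : ℝ) 1 :=
  ⟨sub_nonneg.2 hx.2, sub_le_self _ hx.1⟩

variable (lam rho : DegreeDist)

lemma bec_mem_Icc {ε : ℝ} (hε : ε ∈ Set.Icc (0 : ℝ) 1) (l : ℕ) :
    bec lam rho ε l ∈ Set.Icc (0 : ℝ) 1 := by
  induction l with
  | zero => exact hε
  | succ l ih =>
    have h := lam.eval_mem_Icc (one_sub_mem_Icc (rho.eval_mem_Icc (one_sub_mem_Icc ih)))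
    exact ⟨mul_nonneg hε.1 h.1, mul_le_one₀ hε.2 h.1 h.2⟩

lemma bec_mono {ε ε' : ℝ} (hε : ε ∈ Set.Icc (0 : ℝ) 1) (hε' : ε' ∈ Set.Icc (0 : ℝ) 1)
    (h : ε ≤ ε') (l : ℕ) : bec lam rho ε l ≤ bec lam rho ε' l := by
  induction l with
  | zero => exact h
  | succ l ih =>
    have h1 := bec_mem_Icc lam rho hε l
    have h2 := bec_mem_Icc lam rho hε' l
    have h3 := one_sub_mem_Icc (rho.eval_mem_Icc (one_sub_mem_Icc h1))
    have h4 := rho.eval_mono (one_sub_mem_Icc h2).1 (sub_le_sub_left ih 1)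
    exact mul_le_mul h (lam.eval_mono h3.1 (sub_le_sub_left h4 1)) (lam.eval_mem_Icc h3).1 hε'.1

lemma tendsto_bec_of_le {ε ε' : ℝ} (hε : ε ∈ Set.Icc (0 : ℝ) 1) (hε' : ε' ∈ Set.Icc (0 : ℝ) 1)
    (h : ε ≤ ε') (ht : Tendsto (bec lam rho ε') atTop (𝓝 0)) :
    Tendsto (bec lam rho ε) atTop (𝓝 0) :=
  squeeze_zero (fun l => (bec_mem_Icc lam rho hε l).1) (bec_mono lam rho hε hε' h) ht

lemma tendsto_bec_zero : Tendsto (bec lam rho 0) atTop (𝓝 0) := by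
  have : bec lam rho 0 = fun _ => 0 := by
    funext l
    cases l <;> simp [bec]
  rw [this]
  exact tendsto_const_nhds

/-- For a downward closed condition, dilating the admissible set by `c` and truncating at `1` does
the same to its supremum. The bound `1 ≤ c` keeps `x / c` in the unit interval. -/
lemma sSup_Icc_div_eq_min {P : ℝ → Prop} {c : ℝ} (hc : 1 ≤ c) (h0 : P 0)
    (hP : ∀ x ∈ Set.Icc (0 : ℝ) 1, ∀ y ∈ Set.Icc (0 : ℝ) 1, x ≤ y → P y → P x) :
    sSup {x | x ∈ Set.Icc (0 : ℝ) 1 ∧ P (x / c)}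
      = min 1 (c * sSup {x | x ∈ Set.Icc (0 : ℝ) 1 ∧ P x}) := by
  have hc0 : 0 < c := by linarith
  have hdiv : ∀ x ∈ Set.Icc (0 : ℝ) 1, x / c ∈ Set.Icc (0 : ℝ) 1 := fun x hx =>
    ⟨div_nonneg hx.1 hc0.le, (div_le_one hc0).2 (hx.2.trans hc)⟩
  have hz : (0 : ℝ) ∈ Set.Icc (0 : ℝ) 1 := ⟨le_rfl, zero_le_one⟩
  have hbA : BddAbove {x | x ∈ Set.Icc (0 : ℝ) 1 ∧ P (x / c)} := ⟨1, fun x hx => hx.1.2⟩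
  have hbS : BddAbove {x | x ∈ Set.Icc (0 : ℝ) 1 ∧ P x} := ⟨1, fun x hx => hx.1.2⟩
  have hA0 : (0 : ℝ) ∈ {x | x ∈ Set.Icc (0 : ℝ) 1 ∧ P (x / c)} := ⟨hz, by rwa [zero_div]⟩
  refine le_antisymm (csSup_le ⟨0, hA0⟩ ?_) (le_of_forall_lt_imp_le_of_dense fun a ha => ?_)
  · rintro x ⟨hx, hPx⟩
    refine le_min hx.2 ?_
    rw [← div_le_iff₀' hc0]
    exact le_csSup hbS ⟨hdiv x hx, hPx⟩
  · rcases lt_or_ge a 0 with h | h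
    · exact h.le.trans (le_csSup hbA hA0)
    · obtain ⟨h1, h2⟩ := lt_min_iff.1 ha
      rw [← div_lt_iff₀' hc0] at h2
      obtain ⟨e, ⟨he, hPe⟩, h3⟩ := exists_lt_of_lt_csSup
        (s := {x | x ∈ Set.Icc (0 : ℝ) 1 ∧ P x}) ⟨0, hz, h0⟩ h2
      have haI : a ∈ Set.Icc (0 : ℝ) 1 := ⟨h, h1.le⟩
      exact le_csSup hbA ⟨haI, hP _ (hdiv a haI) _ he h3.le hPe⟩

variable {F : Type*} [Field F] [Fintype F] {s j : ℕ} {α : F}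

lemma one_le_div_of_dvd (hF : Fintype.card F = 2 ^ s) (hj : j ∣ s) : (1 : ℝ) ≤ s / j := by
  have hs := pos_of_card hF
  have hj0 := Nat.pos_of_dvd_of_pos hj hs
  rw [one_le_div (by exact_mod_cast hj0)]
  exact_mod_cast Nat.le_of_dvd hs hj

variable [DecidableEq F]

lemma axisThreshold_optLabels (hF : Fintype.card F = 2 ^ s)
    (hα : IsPrimitiveRoot α (2 ^ s - 1)) (hj : j ∣ s) :
    axisThreshold s j (labelRegion s lam rho α (optLabels α s j))
      = min 1 ((s : ℝ) / j * becThreshold lam rho) := by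
  have h := sSup_Icc_div_eq_min (P := fun x => Tendsto (bec lam rho x) atTop (𝓝 0))
    (one_le_div_of_dvd hF hj) (tendsto_bec_zero lam rho)
    (fun x hx y hy hxy => tendsto_bec_of_le lam rho hx hy hxy)
  rw [becThreshold, ← h, axisThreshold]
  congr 1
  ext x
  refine and_congr_right fun hx => ?_
  rw [single_mem_labelRegion_iff hF hα hj lam rho hx, div_div_eq_mul_div]

lemma tendsto_axisThreshold_optLabels (hF : Fintype.card F = 2 ^ s)
    (hα : IsPrimitiveRoot α (2 ^ s - 1)) (hj : j ∣ s) {lam rho : ℕ → DegreeDist} {δ : ℝ}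
    (hδ : (s : ℝ) / j * δ ≤ 1)
    (h : Tendsto (fun n => becThreshold (lam n) (rho n)) atTop (𝓝 δ)) :
    Tendsto (fun n => axisThreshold s j (labelRegion s (lam n) (rho n) α (optLabels α s j)))
      atTop (𝓝 ((s : ℝ) / j * δ)) := by
  simp only [axisThreshold_optLabels _ _ hF hα hj]
  have := (tendsto_const_nhds (x := (1 : ℝ))).min (h.const_mul ((s : ℝ) / j))
  rwa [min_eq_right hδ] at this

lemma becThreshold_nonneg : 0 ≤ becThreshold lam rho :=
  Real.sSup_nonneg fun _ hx => hx.1.1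

end Threshold

/-! ### Capacity of the channel with a single erasure type. -/

section Capacity

variable {s j : ℕ}

lemma mem_outputSet {x y : Fin (2 ^ s)} : y ∈ outputSet s j x ↔ (y : ℕ) / 2 ^ j = x / 2 ^ j := by
  simp [outputSet]

lemma outputSet_eq_iff {x y : Fin (2 ^ s)} :
    outputSet s j x = outputSet s j y ↔ (x : ℕ) / 2 ^ j = y / 2 ^ j := by
  constructor
  · intro h
    have : x ∈ outputSet s j x := mem_outputSet.2 rfl
    rw [h] at this
    exact mem_outputSet.1 this
  · intro h
    ext z
    rw [mem_outputSet, mem_outputSet, h]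

lemma card_outputSet (hj : j ≤ s) (x : Fin (2 ^ s)) : (outputSet s j x).card = 2 ^ j := by
  have hp : 0 < 2 ^ j := by positivity
  have hsj : 2 ^ s = 2 ^ (s - j) * 2 ^ j := by rw [← pow_add, Nat.sub_add_cancel hj]
  have hx : (x : ℕ) / 2 ^ j < 2 ^ (s - j) := by
    rw [Nat.div_lt_iff_lt_mul hp, ← hsj]
    exact x.2
  rw [← Finset.card_range (2 ^ j)]
  symm
  refine Finset.card_bij (fun t ht => ⟨(x : ℕ) / 2 ^ j * 2 ^ j + t, ?_⟩) ?_ ?_ ?_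
  · have h1 := Nat.mul_le_mul_right (2 ^ j) (Nat.succ_le_of_lt hx)
    rw [← hsj, Nat.succ_mul] at h1
    have := Finset.mem_range.1 ht
    omega
  · intro t ht
    rw [mem_outputSet]
    simp only
    rw [Nat.add_comm, Nat.add_mul_div_right _ _ hp, Nat.div_eq_of_lt (Finset.mem_range.1 ht),
      zero_add]
  · intro t _ t' _ h
    simpa using h
  · intro y hy
    rw [mem_outputSet] at hy
    refine ⟨(y : ℕ) % 2 ^ j, Finset.mem_range.2 (Nat.mod_lt _ hp), Fin.ext ?_⟩
    simp only
    rw [← hy]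
    exact Nat.div_add_mod' _ _

/-- The probability that the input agrees with `x` up to a type-`j` partial erasure. -/
noncomputable def blockMass (s j : ℕ) (p : Fin (2 ^ s) → ℝ) (x : Fin (2 ^ s)) : ℝ :=
  ∑ y, if outputSet s j y = outputSet s j x then p y else 0

lemma transition_single (hj0 : 0 < j) (hj : j ≤ s) (e : ℝ) (x : Fin (2 ^ s))
    (S : Finset (Fin (2 ^ s))) : transition s (single s j e) x S
      = e * (if outputSet s j x = S then 1 else 0)
        + (1 - e) * (if outputSet s 0 x = S then 1 else 0) := by
  rw [← sum_single_mul hj0 hj e (fun t => if outputSet s t x = S then 1 else 0)]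
  simp [transition]

/-- The cardinalities `2^j` and `1` differ, so the receiver knows whether a partial erasure
occurred. -/
lemma outputSet_ne_zero (hj0 : 0 < j) (hj : j ≤ s) (x y : Fin (2 ^ s)) :
    outputSet s j x ≠ outputSet s 0 y := by
  intro h
  have h1 := congrArg Finset.card h
  rw [card_outputSet hj, card_outputSet (Nat.zero_le s)] at h1
  have := Nat.pow_right_injective le_rfl h1
  omega

lemma mul_logb_self_div_mul (b e P : ℝ) :
    e * Real.logb b (e / (e * P)) = -(e * Real.logb b P) := by
  rcases eq_or_ne e 0 with rfl | he
  · simp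
  · rw [div_mul_cancel_left₀ he, Real.logb_inv]
    ring

/-- With the erasure type visible, the information is the entropy of the block with weight `e` plus
that of the symbol with weight `1 - e`; each entropy is written as a sum over symbols. -/
lemma mutualInfo_single (hj0 : 0 < j) (hj : j ≤ s) (e : ℝ) (p : Fin (2 ^ s) → ℝ) :
    mutualInfo s (single s j e) p
      = e * ∑ x, -(p x * Real.logb (2 ^ s) (blockMass s j p x))
        + (1 - e) * ∑ x, -(p x * Real.logb (2 ^ s) (blockMass s 0 p x)) := by
  unfold mutualInfo
  rw [Finset.mul_sum, Finset.mul_sum, ← Finset.sum_add_distrib]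
  refine Finset.sum_congr rfl fun x _ => ?_
  have hT : ∀ S, p x * transition s (single s j e) x S *
      Real.logb (2 ^ s) (transition s (single s j e) x S /
        ∑ x', p x' * transition s (single s j e) x' S)
      = (if outputSet s j x = S then p x * (e * Real.logb (2 ^ s) (e / (e * blockMass s j p x)))
          else 0)
        + (if outputSet s 0 x = S then
          p x * ((1 - e) * Real.logb (2 ^ s) ((1 - e) / ((1 - e) * blockMass s 0 p x)))
          else 0) := by
    intro S
    by_cases h1 : outputSet s j x = S
    · subst h1
      have hsum : ∑ x', p x' * transition s (single s j e) x' (outputSet s j x)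
          = e * blockMass s j p x := by
        rw [blockMass, Finset.mul_sum]
        refine Finset.sum_congr rfl fun y _ => ?_
        rw [transition_single hj0 hj, if_neg (outputSet_ne_zero hj0 hj x y).symm]
        split_ifs <;> ring
      rw [hsum, transition_single hj0 hj, if_neg (outputSet_ne_zero hj0 hj x x).symm, if_pos rfl,
        if_pos rfl, if_neg (outputSet_ne_zero hj0 hj x x).symm]
      ring_nf
    · by_cases h0 : outputSet s 0 x = S
      · subst h0
        have hsum : ∑ x', p x' * transition s (single s j e) x' (outputSet s 0 x)
            = (1 - e) * blockMass s 0 p x := by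
          rw [blockMass, Finset.mul_sum]
          refine Finset.sum_congr rfl fun y _ => ?_
          rw [transition_single hj0 hj, if_neg (outputSet_ne_zero hj0 hj y x)]
          split_ifs <;> ring
        rw [hsum, transition_single hj0 hj, if_neg h1, if_pos rfl, if_neg h1, if_pos rfl]
        ring_nf
      · rw [transition_single hj0 hj, if_neg h1, if_neg h0, if_neg h1, if_neg h0]
        ring
  simp only [hT, Finset.sum_add_distrib, Finset.sum_ite_eq, Finset.mem_univ, if_true,
    mul_logb_self_div_mul]
  ring

lemma logb_two_pow (hs : 0 < s) (k : ℕ) : Real.logb (2 ^ s) (2 ^ k) = (k : ℝ) / s := by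
  have : Real.log 2 ≠ 0 := (Real.log_pos (by norm_num)).ne'
  have hs' : (s : ℝ) ≠ 0 := by exact_mod_cast hs.ne'
  rw [Real.logb, Real.log_pow, Real.log_pow]
  field_simp

/-- Each of the `2^(s-j)` blocks contributes its mass divided by itself, which is `1`, or `0` under
the convention `0 / 0 = 0`. -/
lemma sum_div_blockMass_le (hj : j ≤ s) {p : Fin (2 ^ s) → ℝ} :
    ∑ x, p x / blockMass s j p x ≤ 2 ^ (s - j) := by
  have hp : 0 < 2 ^ j := by positivity
  have hsj : 2 ^ s = 2 ^ (s - j) * 2 ^ j := by rw [← pow_add, Nat.sub_add_cancel hj]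
  have hmap : ∀ x ∈ (Finset.univ : Finset (Fin (2 ^ s))),
      (x : ℕ) / 2 ^ j ∈ Finset.range (2 ^ (s - j)) := by
    intro x _
    rw [Finset.mem_range, Nat.div_lt_iff_lt_mul hp, ← hsj]
    exact x.2
  rw [← Finset.sum_fiberwise_of_maps_to hmap]
  have hblock : ∀ a ∈ Finset.range (2 ^ (s - j)),
      ∑ x ∈ Finset.univ.filter (fun x : Fin (2 ^ s) => (x : ℕ) / 2 ^ j = a),
        p x / blockMass s j p x ≤ 1 := by
    intro a _
    have e : ∀ x ∈ Finset.univ.filter (fun x : Fin (2 ^ s) => (x : ℕ) / 2 ^ j = a),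
        p x / blockMass s j p x = p x /
          ∑ y ∈ Finset.univ.filter (fun x : Fin (2 ^ s) => (x : ℕ) / 2 ^ j = a), p y := by
      intro x hx
      simp only [Finset.mem_filter, Finset.mem_univ, true_and] at hx
      rw [blockMass, ← Finset.sum_filter]
      simp only [outputSet_eq_iff, hx]
    rw [Finset.sum_congr rfl e, ← Finset.sum_div]
    exact div_self_le_one _
  refine (Finset.sum_le_sum hblock).trans ?_
  simp

lemma entropy_blockMass_le (hs : 0 < s) (hj : j ≤ s) {p : Fin (2 ^ s) → ℝ}
    (hp : p ∈ stdSimplex ℝ (Fin (2 ^ s))) :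
    ∑ x, -(p x * Real.logb (2 ^ s) (blockMass s j p x)) ≤ ((s - j : ℕ) : ℝ) / s := by
  have hs' : (0 : ℝ) < s := by exact_mod_cast hs
  have hb : 0 < Real.log (2 ^ s : ℝ) := by
    rw [Real.log_pow]
    exact mul_pos hs' (Real.log_pos (by norm_num))
  have hK : (0 : ℝ) < 2 ^ (s - j) := by positivity
  have key : ∀ x, -(p x * Real.log (blockMass s j p x))
      ≤ p x * Real.log (2 ^ (s - j)) + (p x / blockMass s j p x) / 2 ^ (s - j) - p x := by
    intro x
    rcases (hp.1 x).eq_or_lt with h | h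
    · rw [← h]; simp
    · have hP : 0 < blockMass s j p x := by
        refine h.trans_le ?_
        have := Finset.single_le_sum (f := fun y => if outputSet s j y = outputSet s j x
          then p y else 0) (fun y _ => by
            split_ifs
            · exact hp.1 y
            · exact le_rfl) (Finset.mem_univ x)
        simpa [blockMass] using this
      -- Gibbs' inequality against the uniform law on blocks: the argument is the ratio of the
      -- uniform block mass to the actual one.
      have h1 := Real.log_le_sub_one_of_pos (x := (blockMass s j p x * 2 ^ (s - j))⁻¹)
        (by positivity)
      rw [Real.log_inv, Real.log_mul hP.ne' hK.ne'] at h1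
      have h2 := mul_le_mul_of_nonneg_left h1 h.le
      have h3 : p x * ((blockMass s j p x * 2 ^ (s - j))⁻¹ - 1)
          = (p x / blockMass s j p x) / 2 ^ (s - j) - p x := by
        rw [mul_inv, mul_sub, mul_one, ← mul_assoc, ← div_eq_mul_inv, ← div_eq_mul_inv]
      rw [h3] at h2
      linarith
  have hsum := Finset.sum_le_sum fun x (_ : x ∈ Finset.univ) => key x
  rw [Finset.sum_sub_distrib, Finset.sum_add_distrib, ← Finset.sum_mul, hp.2, one_mul,
    ← Finset.sum_div] at hsum
  have h4 : (∑ x, p x / blockMass s j p x) / 2 ^ (s - j) ≤ 1 :=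
    (div_le_one hK).2 (sum_div_blockMass_le hj)
  rw [← logb_two_pow hs (s - j)]
  simp only [Real.logb, mul_div_assoc', neg_div']
  rw [← Finset.sum_div, div_le_div_iff_of_pos_right hb]
  linarith

lemma entropy_blockMass_uniform (hs : 0 < s) (hj : j ≤ s) :
    ∑ x, -((2 ^ s : ℝ)⁻¹ * Real.logb (2 ^ s) (blockMass s j (fun _ => (2 ^ s : ℝ)⁻¹) x))
      = ((s - j : ℕ) : ℝ) / s := by
  have e : ∀ x, blockMass s j (fun _ => (2 ^ s : ℝ)⁻¹) x = (2 ^ (s - j))⁻¹ := by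
    intro x
    have h1 : Finset.univ.filter (fun y => outputSet s j y = outputSet s j x)
        = outputSet s j x := by
      ext y
      simp [outputSet_eq_iff, mem_outputSet]
    rw [blockMass, ← Finset.sum_filter, h1, Finset.sum_const, card_outputSet hj, nsmul_eq_mul]
    have h2 : (2 : ℝ) ^ s = 2 ^ (s - j) * 2 ^ j := by rw [← pow_add, Nat.sub_add_cancel hj]
    rw [h2]
    push_cast
    field_simp
  simp only [e, Real.logb_inv, logb_two_pow hs]
  simp

lemma uniform_mem_stdSimplex (s : ℕ) :
    (fun _ => (2 ^ s : ℝ)⁻¹) ∈ stdSimplex ℝ (Fin (2 ^ s)) :=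
  ⟨fun _ => by positivity, by simp⟩

lemma capacity_single (hj0 : 0 < j) (hj : j ≤ s) {e : ℝ} (he : e ∈ Set.Icc (0 : ℝ) 1) :
    capacity s (single s j e) = 1 - e * j / s := by
  have hs : 0 < s := hj0.trans_le hj
  have hs' : (s : ℝ) ≠ 0 := by exact_mod_cast hs.ne'
  have hval : e * (((s - j : ℕ) : ℝ) / s) + (1 - e) * (((s - 0 : ℕ) : ℝ) / s)
      = 1 - e * j / s := by
    rw [Nat.cast_sub hj, Nat.sub_zero, div_self hs']
    field_simp
    ring
  refine IsGreatest.csSup_eq ⟨⟨_, uniform_mem_stdSimplex s, ?_⟩, ?_⟩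
  · rw [mutualInfo_single hj0 hj, entropy_blockMass_uniform hs hj,
      entropy_blockMass_uniform hs (Nat.zero_le s), hval]
  · rintro _ ⟨p, hp, rfl⟩
    rw [mutualInfo_single hj0 hj, ← hval]
    exact add_le_add (mul_le_mul_of_nonneg_left (entropy_blockMass_le hs hj hp) he.1)
      (mul_le_mul_of_nonneg_left (entropy_blockMass_le hs (Nat.zero_le s) hp)
        (sub_nonneg.2 he.2))

end Capacity

/-- Passage from nodes to edges: with i.i.d. inputs each of the `n + 1` edges contributes the same
average when singled out, hence the division by the degree. -/
lemma avg_node {A : Type*} [Fintype A] {n : ℕ} {v : A → ℝ} (hv : ∀ a, 0 ≤ v a)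
    {D : A → (Fin n → A) → ℝ} {g : (Fin (n + 1) → A) → ℝ}
    (h : ∀ x, (∀ k, v (x k) ≠ 0) → ∑ k, D (x k) (fun i => x (k.succAbove i)) ≤ g x) :
    ∑ a, v a * avg v (D a) ≤ avg v g / (n + 1) := by
  have h1 := avg_mono hv h
  rw [avg_sum] at h1
  simp only [avg_succAbove, Finset.sum_const, Finset.card_univ, Fintype.card_fin,
    nsmul_eq_mul] at h1
  rw [le_div_iff₀ (by positivity), mul_comm]
  exact_mod_cast h1

lemma eq_dirac_of_support {A : Type*} [Fintype A] {z : A → ℝ} (hz : z ∈ stdSimplex ℝ A) {a : A}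
    (h : ∀ b, z b ≠ 0 → b = a) : z = dirac a := by
  classical
  have h0 : ∀ b, b ≠ a → z b = 0 := fun b hb => by
    by_contra hn
    exact hb (h b hn)
  have h1 : z a = 1 := by
    rw [← hz.2, Finset.sum_eq_single a (fun b _ hb => h0 b hb) (by simp)]
  funext b
  by_cases hb : b = a
  · rw [hb, h1, dirac, if_pos rfl]
  · rw [h0 b hb, dirac, if_neg hb]

lemma eq_of_dirac_ne_zero {A : Type*} {a b : A} (h : dirac a b ≠ 0) : b = a := by
  by_contra hn
  exact h (if_neg hn)

lemma dirac_mem_stdSimplex {A : Type*} [Fintype A] (a : A) : dirac a ∈ stdSimplex ℝ A := by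
  refine ⟨fun b => ?_, by simpa using sum_dirac_mul a fun _ => 1⟩
  unfold dirac
  split_ifs <;> norm_num

lemma continuous_avg {A X : Type*} [Fintype A] [TopologicalSpace X] {n : ℕ} {v : X → A → ℝ}
    (hv : ∀ a, Continuous fun x => v x a) (g : (Fin n → A) → ℝ) :
    Continuous fun x => avg (v x) g := by
  unfold avg
  fun_prop

/-! ### Monotone couplings of message distributions. -/

section StochLE

/-- Stochastic domination: there is a coupling of the two distributions under which the first
message is contained in the second. -/
def StochLE {A : Type*} [Fintype A] [LE A] (z' z : A → ℝ) : Prop :=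
  ∃ π : A × A → ℝ, (∀ p, 0 ≤ π p) ∧ (∀ p, π p ≠ 0 → p.1 ≤ p.2) ∧
    IsPush π Prod.fst z' ∧ IsPush π Prod.snd z

lemma stochLE_dirac_top {A : Type*} [Fintype A] [LE A] [OrderTop A] {z : A → ℝ}
    (hz : z ∈ stdSimplex ℝ A) : StochLE z (dirac ⊤) := by
  have hd := dirac_mem_stdSimplex (⊤ : A)
  refine ⟨fun p => z p.1 * dirac ⊤ p.2, fun p => mul_nonneg (hz.1 _) (hd.1 _), fun p hp => ?_,
    fun f => ?_, fun f => ?_⟩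
  · rw [eq_of_dirac_ne_zero (right_ne_zero_of_mul hp)]
    exact le_top
  · rw [Fintype.sum_prod_type]
    refine Finset.sum_congr rfl fun a _ => ?_
    dsimp only
    rw [← Finset.sum_mul, ← Finset.mul_sum, hd.2, mul_one]
  · rw [Fintype.sum_prod_type, Finset.sum_comm]
    refine Finset.sum_congr rfl fun a _ => ?_
    dsimp only
    rw [← Finset.sum_mul, ← Finset.sum_mul, hz.2, one_mul]

variable {F : Type*} [Field F]

lemma ctvMsg_mono {n : ℕ} (hout : Fˣ) (hin : Fin n → Fˣ) {m m' : Fin n → AddSubgroup F}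
    (h : ∀ k, m k ≤ m' k) : ctvMsg hout hin m ≤ ctvMsg hout hin m' :=
  iSup_mono fun k => AddSubgroup.map_mono (h k)

lemma vtcMsg_mono {n : ℕ} (C : AddSubgroup F) {m m' : Fin n → AddSubgroup F}
    (h : ∀ k, m k ≤ m' k) : vtcMsg C m ≤ vtcMsg C m' :=
  inf_le_inf_left _ (iInf_mono h)

variable [Fintype F] {s : ℕ}

/-- Both copies use the same degree and channel subgroup; the coupled inputs then stay ordered
because intersection is monotone. -/
lemma StochLE.varUpdate {lam : DegreeDist} {α : F} {ε : Fin (s + 1) → ℝ} (hε : ∀ i, 0 ≤ ε i)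
    {w' w : AddSubgroup F → ℝ} (h : StochLE w' w) :
    StochLE (varUpdate lam α ε w') (varUpdate lam α ε w) := by
  obtain ⟨π, h0, hle, h1, h2⟩ := h
  rw [varUpdate_eq_mix, varUpdate_eq_mix]
  refine ⟨mix (lam.coeff.support ×ˢ (Finset.univ : Finset (Fin (s + 1))))
    (fun i => lam.coeff i.1 * ε i.2) (fun i => i.1 - 1) π
    (fun i x => (vtcMsg (chanSubgroup α i.2) (fun k => (x k).1),
      vtcMsg (chanSubgroup α i.2) (fun k => (x k).2))),
    mix_nonneg (fun i _ => mul_nonneg (lam.nonneg _) (hε _)) h0, fun p hp => ?_,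
    isPush_mix h1 fun _ _ => rfl, isPush_mix h2 fun _ _ => rfl⟩
  obtain ⟨i, _, _, x, hx, rfl⟩ := exists_of_mix_ne_zero hp
  exact vtcMsg_mono _ fun k => hle _ (hx k)

variable [DecidableEq F]

lemma StochLE.checkUpdate {rho : DegreeDist} {L : Fˣ → ℝ} (hL : ∀ h, 0 ≤ L h)
    {z' z : AddSubgroup F → ℝ} (h : StochLE z' z) :
    StochLE (checkUpdate rho L z') (checkUpdate rho L z) := by
  obtain ⟨π, h0, hle, h1, h2⟩ := h
  rw [checkUpdate_eq_mix, checkUpdate_eq_mix]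
  refine ⟨mix (rho.coeff.support ×ˢ (Finset.univ : Finset Fˣ))
    (fun i => rho.coeff i.1 * L i.2) (fun i => i.1 - 1) (labelled L π)
    (fun i x => (ctvMsg i.2 (fun k => (x k).1) (fun k => (x k).2.1),
      ctvMsg i.2 (fun k => (x k).1) (fun k => (x k).2.2))),
    mix_nonneg (fun i _ => mul_nonneg (rho.nonneg _) (hL _))
      (fun p => mul_nonneg (hL _) (h0 _)), fun p hp => ?_,
    isPush_mix (isPush_labelled L h1) fun _ _ => rfl,
    isPush_mix (isPush_labelled L h2) fun _ _ => rfl⟩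
  obtain ⟨i, _, _, x, hx, rfl⟩ := exists_of_mix_ne_zero hp
  exact ctvMsg_mono _ _ fun k => hle _ (right_ne_zero_of_mul (hx k))

end StochLE

/-! ### A potential that is nondecreasing along density evolution. -/

section Potential

variable {F : Type*} [Field F]

/-- The message on an edge, multiplied by the label of the edge. -/
def scaled (p : Fˣ × AddSubgroup F) : AddSubgroup F := p.2.map (AddMonoidHom.mulLeft (p.1 : F))

lemma scaled_mono (h : Fˣ) {H H' : AddSubgroup F} (hH : H ≤ H') :
    scaled (h, H) ≤ scaled (h, H') :=
  AddSubgroup.map_mono hH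

lemma mulLeft_injective (h : Fˣ) : Function.Injective (AddMonoidHom.mulLeft (h : F)) :=
  fun _ _ e => mul_left_cancel₀ h.ne_zero e

lemma map_mulLeft_top {c : F} (hc : c ≠ 0) :
    (⊤ : AddSubgroup F).map (AddMonoidHom.mulLeft c) = ⊤ :=
  AddSubgroup.map_top_of_surjective _ fun y => ⟨c⁻¹ * y, by simp [hc]⟩

/-- Multiplying through by the output label preserves dimension and makes a check node symmetric in
all its edges, so any edge can play the role of the output. -/
lemma dim_scaled_inf {n : ℕ} (a : Fˣ × AddSubgroup F) (x : Fin n → Fˣ × AddSubgroup F) :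
    dim (scaled a ⊓ ⨆ k, scaled (x k))
      = dim (a.2 ⊓ ctvMsg a.1 (fun k => (x k).1) (fun k => (x k).2)) := by
  rw [← dim_map _ (mulLeft_injective a.1) (a.2 ⊓ _), AddSubgroup.map_inf _ _ _ (mulLeft_injective a.1),
    ctvMsg, AddSubgroup.map_iSup]
  congr 3
  funext k
  rw [AddSubgroup.map_map]
  unfold scaled
  congr 1
  ext y
  simp [← mul_assoc, mul_div_cancel₀]

variable [Fintype F]

/-- Expected dimension of the intersection of two independent messages. -/
noncomputable def edgeTerm (z w : AddSubgroup F → ℝ) : ℝ :=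
  ∑ W, w W * ∑ Z, z Z * dim (W ⊓ Z)

lemma edgeTerm_comm (z w : AddSubgroup F → ℝ) : edgeTerm z w = edgeTerm w z := by
  simp only [edgeTerm, Finset.mul_sum]
  rw [Finset.sum_comm]
  refine Finset.sum_congr rfl fun Z _ => Finset.sum_congr rfl fun W _ => ?_
  rw [inf_comm]
  ring

/-- Contribution of the variable nodes to the potential. -/
noncomputable def varTerm {s : ℕ} (lam : DegreeDist) (α : F) (ε : Fin (s + 1) → ℝ)
    (w : AddSubgroup F → ℝ) : ℝ :=
  ∑ i ∈ lam.coeff.support ×ˢ (Finset.univ : Finset (Fin (s + 1))), lam.coeff i.1 * ε i.2 *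
    (avg w (fun x : Fin (i.1 - 1 + 1) → AddSubgroup F => dim (chanSubgroup α i.2 ⊓ ⨅ k, x k))
      / ((i.1 - 1 : ℕ) + 1))

/-- On the left only one edge of a node moves from `w` to `w'`, on the right all of them do;
pointwise under the coupling this is `sum_dim_vtc_le`. -/
lemma edgeTerm_sub_le_varTerm_sub {s : ℕ} {lam : DegreeDist} {α : F} {ε : Fin (s + 1) → ℝ}
    (hε : ∀ i, 0 ≤ ε i) {w' w : AddSubgroup F → ℝ} (h : StochLE w' w) :
    edgeTerm (varUpdate lam α ε w) w' - edgeTerm (varUpdate lam α ε w) w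
      ≤ varTerm lam α ε w' - varTerm lam α ε w := by
  obtain ⟨π, h0, hle, h1, h2⟩ := h
  -- Both edge terms become averages over the same coupling: `φ` selects a component for the
  -- distinguished edge, and the other edges always use the larger one.
  have e : ∀ (v : AddSubgroup F → ℝ) (φ : AddSubgroup F × AddSubgroup F → AddSubgroup F),
      IsPush π φ v → edgeTerm (varUpdate lam α ε w) v =
      ∑ i ∈ lam.coeff.support ×ˢ (Finset.univ : Finset (Fin (s + 1))), lam.coeff i.1 * ε i.2 *
        ∑ a, π a * avg π (fun x : Fin (i.1 - 1) → AddSubgroup F × AddSubgroup F =>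
          dim (φ a ⊓ (chanSubgroup α i.2 ⊓ ⨅ k, (x k).2))) := by
    intro v φ hφ
    rw [edgeTerm, hφ, varUpdate_eq_mix]
    simp only [sum_mix_mul, Finset.mul_sum]
    rw [Finset.sum_comm]
    refine Finset.sum_congr rfl fun i _ => Finset.sum_congr rfl fun a _ => ?_
    rw [avg_push h2]
    simp only [vtcMsg]
    ring
  rw [e w' _ h1, e w _ h2, varTerm, varTerm, ← Finset.sum_sub_distrib, ← Finset.sum_sub_distrib]
  refine Finset.sum_le_sum fun i _ => ?_
  rw [← mul_sub, ← mul_sub, ← Finset.sum_sub_distrib, ← sub_div]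
  refine mul_le_mul_of_nonneg_left ?_ (mul_nonneg (lam.nonneg _) (hε _))
  simp only [← mul_sub, ← avg_sub]
  rw [avg_push h1, avg_push h2, ← avg_sub]
  refine avg_node (D := fun a x => dim (a.1 ⊓ (chanSubgroup α i.2 ⊓ ⨅ k, (x k).2))
    - dim (a.2 ⊓ (chanSubgroup α i.2 ⊓ ⨅ k, (x k).2))) h0 fun x hx => ?_
  exact sum_dim_vtc_le (chanSubgroup α i.2) (a := fun k => (x k).1) (b := fun k => (x k).2)
    fun k => hle _ (hx k)

variable [DecidableEq F]

/-- Contribution of the check nodes to the potential. -/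
noncomputable def checkTerm (rho : DegreeDist) (L : Fˣ → ℝ) (z : AddSubgroup F → ℝ) : ℝ :=
  ∑ i ∈ rho.coeff.support, rho.coeff i *
    (avg (labelled L z) (fun x : Fin (i - 1 + 1) → Fˣ × AddSubgroup F =>
      ∑ k, dim (scaled (x k)) - dim (⨆ k, scaled (x k))) / ((i - 1 : ℕ) + 1))

/-- The check-node counterpart, from `sum_dim_ctv_le`. The sum of the dimensions minus the dimension
of the join is the dimension of the tuples in the scaled messages that add up to zero. -/
lemma edgeTerm_sub_le_checkTerm_sub {rho : DegreeDist} {L : Fˣ → ℝ} (hL : ∀ h, 0 ≤ L h)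
    {z' z : AddSubgroup F → ℝ} (h : StochLE z' z) :
    edgeTerm (checkUpdate rho L z) z' - edgeTerm (checkUpdate rho L z) z
      ≤ checkTerm rho L z' - checkTerm rho L z := by
  obtain ⟨π, h0, hle, h1, h2⟩ := h
  have e : ∀ (v : AddSubgroup F → ℝ) (φ : AddSubgroup F × AddSubgroup F → AddSubgroup F),
      IsPush π φ v → edgeTerm (checkUpdate rho L z) v =
      ∑ i ∈ rho.coeff.support, rho.coeff i * ∑ a, labelled L π a * avg (labelled L π)
        (fun x : Fin (i - 1) → Fˣ × (AddSubgroup F × AddSubgroup F) =>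
          dim (scaled (a.1, φ a.2) ⊓ ⨆ k, scaled ((x k).1, (x k).2.2))) := by
    intro v φ hφ
    rw [edgeTerm, hφ, checkUpdate_eq_mix]
    simp only [sum_mix_mul, Finset.sum_product, Finset.mul_sum]
    rw [Finset.sum_comm]
    refine Finset.sum_congr rfl fun i _ => ?_
    rw [Finset.sum_comm]
    conv_rhs => rw [Fintype.sum_prod_type]
    refine Finset.sum_congr rfl fun b _ => ?_
    refine Finset.sum_congr rfl fun c _ => ?_
    rw [avg_push (isPush_labelled L h2)]
    simp only [dim_scaled_inf, labelled]
    ring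
  rw [e z' _ h1, e z _ h2, checkTerm, checkTerm, ← Finset.sum_sub_distrib,
    ← Finset.sum_sub_distrib]
  refine Finset.sum_le_sum fun i _ => ?_
  rw [← mul_sub, ← mul_sub, ← Finset.sum_sub_distrib, ← sub_div]
  refine mul_le_mul_of_nonneg_left ?_ (rho.nonneg _)
  simp only [← mul_sub, ← avg_sub]
  rw [avg_push (isPush_labelled L h1), avg_push (isPush_labelled L h2), ← avg_sub]
  have hnode : ∀ x : Fin (i - 1 + 1) → Fˣ × (AddSubgroup F × AddSubgroup F),
      (∀ k, labelled L π (x k) ≠ 0) →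
      ∑ k, (dim (scaled ((x k).1, (x k).2.1) ⊓
          ⨆ t, scaled ((x (k.succAbove t)).1, (x (k.succAbove t)).2.2))
        - dim (scaled ((x k).1, (x k).2.2) ⊓
          ⨆ t, scaled ((x (k.succAbove t)).1, (x (k.succAbove t)).2.2)))
      ≤ ∑ k, dim (scaled ((x k).1, (x k).2.1)) - dim (⨆ k, scaled ((x k).1, (x k).2.1))
        - (∑ k, dim (scaled ((x k).1, (x k).2.2)) - dim (⨆ k, scaled ((x k).1, (x k).2.2))) :=
    fun x hx => sum_dim_ctv_le (a := fun k => scaled ((x k).1, (x k).2.1))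
      (b := fun k => scaled ((x k).1, (x k).2.2))
      fun k => scaled_mono _ (hle _ (right_ne_zero_of_mul (hx k)))
  exact avg_node (n := i - 1) (A := Fˣ × (AddSubgroup F × AddSubgroup F))
    (D := fun a x => dim (scaled (a.1, a.2.1) ⊓ ⨆ k, scaled ((x k).1, (x k).2.2))
      - dim (scaled (a.1, a.2.2) ⊓ ⨆ k, scaled ((x k).1, (x k).2.2)))
    (fun p => mul_nonneg (hL _) (h0 _)) hnode

/-- The potential of a message distribution `z` and its check-node update. -/
noncomputable def potential {s : ℕ} (lam rho : DegreeDist) (α : F) (L : Fˣ → ℝ)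
    (ε : Fin (s + 1) → ℝ) (z : AddSubgroup F → ℝ) : ℝ :=
  varTerm lam α ε (checkUpdate rho L z) + checkTerm rho L z - edgeTerm z (checkUpdate rho L z)

variable {s : ℕ} {lam rho : DegreeDist} {α : F} {L : Fˣ → ℝ} {ε : Fin (s + 1) → ℝ}

/-- In the sum of the check and variable inequalities, the mixed edge term between the new `z` and
the old check message cancels. -/
lemma potential_le_of_stochLE (hL : ∀ h, 0 ≤ L h) (hε : ∀ i, 0 ≤ ε i) {z : AddSubgroup F → ℝ}
    (h : StochLE (varUpdate lam α ε (checkUpdate rho L z)) z) :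
    potential lam rho α L ε z
      ≤ potential lam rho α L ε (varUpdate lam α ε (checkUpdate rho L z)) := by
  have h1 := edgeTerm_sub_le_checkTerm_sub (rho := rho) hL h
  have h2 := edgeTerm_sub_le_varTerm_sub (lam := lam) (α := α) hε (h.checkUpdate (rho := rho) hL)
  unfold potential
  rw [edgeTerm_comm z]
  rw [edgeTerm_comm (checkUpdate rho L z) (varUpdate lam α ε (checkUpdate rho L z))] at h1
  linarith

lemma continuous_checkUpdate (H : AddSubgroup F) :
    Continuous fun z : AddSubgroup F → ℝ => checkUpdate rho L z H := by
  unfold checkUpdate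
  fun_prop

lemma continuous_potential : Continuous (potential lam rho α L ε) := by
  have h1 : Continuous fun z : AddSubgroup F → ℝ => varTerm lam α ε (checkUpdate rho L z) :=
    continuous_finsetSum _ fun i _ => continuous_const.mul
      ((continuous_avg continuous_checkUpdate _).div_const _)
  have h2 : Continuous fun z : AddSubgroup F → ℝ => checkTerm rho L z :=
    continuous_finsetSum _ fun i _ => continuous_const.mul
      ((continuous_avg (fun p => continuous_const.mul (continuous_apply p.2)) _).div_const _)
  have h3 : Continuous fun z : AddSubgroup F → ℝ => edgeTerm z (checkUpdate rho L z) :=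
    continuous_finsetSum _ fun W _ => (continuous_checkUpdate W).mul
      (continuous_finsetSum _ fun Z _ => (continuous_apply Z).mul continuous_const)
  exact (h1.add h2).sub h3

lemma natCast_pred_add_one {d : DegreeDist} {i : ℕ} (hi : i ∈ d.coeff.support) :
    (((i - 1 : ℕ) : ℝ) + 1) = i := by
  have := d.two_le i hi
  exact_mod_cast Nat.sub_add_cancel (by omega : 1 ≤ i)

lemma checkUpdate_dirac_bot (hL : L ∈ stdSimplex ℝ Fˣ) :
    checkUpdate rho L (dirac ⊥) = dirac ⊥ := by
  refine eq_dirac_of_support (checkUpdate_mem_stdSimplex hL (dirac_mem_stdSimplex _))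
    fun W hW => ?_
  rw [checkUpdate_eq_mix] at hW
  obtain ⟨i, _, _, x, hx, rfl⟩ := exists_of_mix_ne_zero hW
  have e : ∀ k, (x k).2 = ⊥ := fun k => eq_of_dirac_ne_zero (right_ne_zero_of_mul (hx k))
  simp [ctvMsg, e]

lemma checkUpdate_dirac_top (hL : L ∈ stdSimplex ℝ Fˣ) :
    checkUpdate rho L (dirac ⊤) = dirac ⊤ := by
  refine eq_dirac_of_support (checkUpdate_mem_stdSimplex hL (dirac_mem_stdSimplex _))
    fun W hW => ?_
  rw [checkUpdate_eq_mix] at hW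
  obtain ⟨i, hi, _, x, hx, rfl⟩ := exists_of_mix_ne_zero hW
  have e : ∀ k, (x k).2 = ⊤ := fun k => eq_of_dirac_ne_zero (right_ne_zero_of_mul (hx k))
  have h2 := rho.two_le _ (Finset.mem_product.1 hi).1
  -- Degree at least `2` leaves at least one input; an empty join would be `⊥`.
  have : Nonempty (Fin (i.1 - 1)) := ⟨⟨0, by omega⟩⟩
  simp only [ctvMsg, e]
  simp [map_mulLeft_top]

lemma potential_dirac_bot (hL : L ∈ stdSimplex ℝ Fˣ) : potential lam rho α L ε (dirac ⊥) = 0 := by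
  have h1 : varTerm lam α ε (dirac (⊥ : AddSubgroup F)) = 0 :=
    Finset.sum_eq_zero fun i _ => by
      rw [avg_dirac]
      simp
  have h2 : checkTerm rho L (dirac (⊥ : AddSubgroup F)) = 0 :=
    Finset.sum_eq_zero fun i _ => by
      rw [avg_congr (g := fun _ => 0 * 1), avg_const_mul]
      · simp
      · intro x hx
        have e : ∀ k, scaled (x k) = ⊥ := fun k => by
          rw [scaled, eq_of_dirac_ne_zero (right_ne_zero_of_mul (hx k)), AddSubgroup.map_bot]
        simp [e]
  have h3 : edgeTerm (dirac (⊥ : AddSubgroup F)) (dirac ⊥) = 0 := by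
    simp [edgeTerm, sum_dirac_mul]
  rw [potential, checkUpdate_dirac_bot hL, h1, h2, h3]
  ring

/-- The edge term cancels the leading `dim ⊤` of the check term. What remains is, per edge, the
channel uncertainty minus the constraints available to resolve it. -/
lemma potential_dirac_top (hL : L ∈ stdSimplex ℝ Fˣ) :
    potential lam rho α L ε (dirac ⊤) = lam.integral * ∑ i, ε i * dim (chanSubgroup α i)
      - dim (⊤ : AddSubgroup F) * rho.integral := by
  have h1 : varTerm lam α ε (dirac (⊤ : AddSubgroup F))
      = lam.integral * ∑ i, ε i * dim (chanSubgroup α i) := by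
    rw [varTerm, Finset.sum_product, DegreeDist.integral, Finset.sum_mul]
    refine Finset.sum_congr rfl fun i hi => ?_
    rw [Finset.mul_sum]
    refine Finset.sum_congr rfl fun t _ => ?_
    rw [avg_dirac, natCast_pred_add_one hi]
    simp only [iInf_top, inf_top_eq]
    ring
  have h2 : checkTerm rho L (dirac (⊤ : AddSubgroup F))
      = dim (⊤ : AddSubgroup F) - dim (⊤ : AddSubgroup F) * rho.integral := by
    have e : checkTerm rho L (dirac (⊤ : AddSubgroup F))
        = ∑ i ∈ rho.coeff.support, (rho.coeff i * dim (⊤ : AddSubgroup F)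
          - dim (⊤ : AddSubgroup F) * (rho.coeff i / i)) := by
      refine Finset.sum_congr rfl fun i hi => ?_
      have hi0 : (i : ℝ) ≠ 0 := by
        have := rho.two_le i hi
        exact_mod_cast (by omega : i ≠ 0)
      rw [avg_congr (g := fun _ => (i * dim (⊤ : AddSubgroup F) - dim (⊤ : AddSubgroup F)) * 1),
        avg_const_mul, avg_one (sum_labelled hL.2 (dirac_mem_stdSimplex _).2),
        natCast_pred_add_one hi]
      · field_simp
      · intro x hx
        have e : ∀ k, scaled (x k) = ⊤ := fun k => by
          rw [scaled, eq_of_dirac_ne_zero (right_ne_zero_of_mul (hx k)),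
            map_mulLeft_top (Units.ne_zero _)]
        simp only [e, Finset.sum_const, Finset.card_univ, Fintype.card_fin, nsmul_eq_mul,
          iSup_const, mul_one]
        rw [← natCast_pred_add_one hi]
        push_cast
        ring
    rw [e, Finset.sum_sub_distrib, ← Finset.sum_mul, ← Finset.mul_sum, rho.sum_eq_one, one_mul]
    rfl
  have h3 : edgeTerm (dirac (⊤ : AddSubgroup F)) (dirac ⊤) = dim (⊤ : AddSubgroup F) := by
    simp [edgeTerm, sum_dirac_mul]
  rw [potential, checkUpdate_dirac_top hL, h1, h2, h3]
  ring

end Potential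

/-! ### Successful decoding bounds the channel parameter by the design rate. -/

section Converse

variable {F : Type*} [Field F] [Fintype F] [DecidableEq F] {s : ℕ} {lam rho : DegreeDist} {α : F}
  {L : Fˣ → ℝ} {ε : Fin (s + 1) → ℝ}

-- The initial distribution is itself an update of the point mass at `⊤`, so the monotonicity
-- arguments can start one step earlier, from total ignorance.
open Classical in
lemma varUpdate_dirac_top (lam rho : DegreeDist) (α : F) (L : Fˣ → ℝ) (ε : Fin (s + 1) → ℝ) :
    varUpdate lam α ε (dirac ⊤) = vtcProb lam rho α L ε 0 := by
  rw [varUpdate_eq_mix]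
  funext H
  unfold mix
  rw [Finset.sum_product]
  simp only [avg_dirac, vtcMsg, iInf_top, inf_top_eq, mul_assoc, ← Finset.mul_sum]
  rw [← Finset.sum_mul]
  have := lam.sum_eq_one
  simp [vtcProb, this]

open Classical in
lemma stochLE_vtcProb_succ (hL : L ∈ stdSimplex ℝ Fˣ) (hε : ε ∈ stdSimplex ℝ (Fin (s + 1)))
    (l : ℕ) : StochLE (vtcProb lam rho α L ε (l + 1)) (vtcProb lam rho α L ε l) := by
  induction l with
  | zero =>
    rw [← varUpdate_dirac_top lam rho α L ε]
    exact StochLE.varUpdate hε.1 (stochLE_dirac_top (checkUpdate_mem_stdSimplex hL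
      (vtcProb_mem_stdSimplex hL hε 0)))
  | succ l ih => exact StochLE.varUpdate hε.1 (ih.checkUpdate hL.1)

open Classical in
lemma potential_dirac_top_le (hL : L ∈ stdSimplex ℝ Fˣ) (hε : ε ∈ stdSimplex ℝ (Fin (s + 1)))
    (l : ℕ) :
    potential lam rho α L ε (dirac ⊤) ≤ potential lam rho α L ε (vtcProb lam rho α L ε l) := by
  induction l with
  | zero =>
    have h := potential_le_of_stochLE (lam := lam) (rho := rho) (α := α) (z := dirac ⊤) hL.1 hε.1
    rw [checkUpdate_dirac_top hL, varUpdate_dirac_top lam rho α L ε] at h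
    exact h (stochLE_dirac_top (vtcProb_mem_stdSimplex hL hε 0))
  | succ l ih => exact ih.trans (potential_le_of_stochLE hL.1 hε.1 (stochLE_vtcProb_succ hL hε l))

open Classical in
lemma tendsto_vtcProb (hL : L ∈ stdSimplex ℝ Fˣ) (hε : ε ∈ stdSimplex ℝ (Fin (s + 1)))
    (h : Tendsto (errorProb lam rho α L ε) atTop (𝓝 0)) :
    Tendsto (vtcProb lam rho α L ε) atTop (𝓝 (dirac ⊥)) := by
  rw [tendsto_pi_nhds]
  intro H
  have hz := fun l => vtcProb_mem_stdSimplex (lam := lam) (rho := rho) (α := α) hL hε l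
  by_cases hH : H = ⊥
  · subst hH
    have e : ∀ l, vtcProb lam rho α L ε l ⊥ = 1 - errorProb lam rho α L ε l := fun l => by
      rw [errorProb_eq hL hε]
      ring
    simp only [e, dirac, if_true]
    simpa using tendsto_const_nhds.sub h
  · rw [dirac, if_neg hH]
    refine squeeze_zero (fun l => (hz l).1 H) (fun l => ?_) h
    exact Finset.single_le_sum (f := vtcProb lam rho α L ε l) (fun H' _ => (hz l).1 H')
      (Finset.mem_filter.2 ⟨Finset.mem_univ H, hH⟩)

/-- If density evolution succeeds then the average dimension of the channel subgroup is at most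
the number of check equations per variable. -/
lemma integral_mul_sum_dim_le (hL : L ∈ stdSimplex ℝ Fˣ) (h : ε ∈ labelRegion s lam rho α L) :
    lam.integral * ∑ i, ε i * dim (chanSubgroup α i)
      ≤ dim (⊤ : AddSubgroup F) * rho.integral := by
  -- The potential at `⊤` bounds every later value from below, hence by continuity also the value at
  -- the limit `dirac ⊥`, which is `0`.
  have h1 := ge_of_tendsto' (((continuous_potential (lam := lam) (rho := rho) (α := α) (L := L)
    (ε := ε)).tendsto _).comp (tendsto_vtcProb hL h.1 h.2)) (potential_dirac_top_le hL h.1)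
  rw [potential_dirac_bot hL, potential_dirac_top hL] at h1
  linarith

lemma DegreeDist.integral_pos (d : DegreeDist) : 0 < d.integral := by
  have hne : d.coeff.support.Nonempty := by
    rw [Finset.nonempty_iff_ne_empty]
    intro h
    have := d.sum_eq_one
    rw [h] at this
    simp at this
  refine Finset.sum_pos (fun i hi => ?_) hne
  have h1 := d.two_le i hi
  have h2 : 0 < d.coeff i := (d.nonneg i).lt_of_ne' (Finsupp.mem_support_iff.1 hi)
  have h3 : (0 : ℝ) < i := by exact_mod_cast (by omega : 0 < i)
  positivity

lemma le_of_single_mem_region {j : ℕ} (hF : Fintype.card F = 2 ^ s)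
    (hα : IsPrimitiveRoot α (2 ^ s - 1)) (hj0 : 0 < j) (hj : j ≤ s) {x : ℝ}
    (h : single s j x ∈ region s lam rho α) :
    x ≤ (s : ℝ) / j * (1 - designRate lam rho) := by
  simp only [region, Set.mem_iUnion] at h
  obtain ⟨L, hL, h⟩ := h
  have h1 := integral_mul_sum_dim_le hL h
  rw [sum_single_mul hj0 hj x (fun t => dim (chanSubgroup α t)), dim_top hF,
    dim_chanSubgroup hF hα hj, chanSubgroup_zero, dim_bot, mul_zero, add_zero] at h1
  have h2 := lam.integral_pos
  have h3 : (0 : ℝ) < j := by exact_mod_cast hj0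
  rw [designRate, sub_sub_cancel, div_mul_div_comm, le_div_iff₀ (by positivity)]
  linarith

end Converse

/-! ### Comparison with the best label distribution. -/

section Optimality

variable {F : Type*} [Field F] [Fintype F] [DecidableEq F] {s j : ℕ} {α : F}

lemma axisThreshold_labelRegion_le (lam rho : DegreeDist) {L : Fˣ → ℝ} (hL : L ∈ stdSimplex ℝ Fˣ) :
    axisThreshold s j (labelRegion s lam rho α L) ≤ axisThreshold s j (region s lam rho α) := by
  have hb : BddAbove {x | x ∈ Set.Icc (0 : ℝ) 1 ∧ single s j x ∈ region s lam rho α} :=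
    ⟨1, fun x hx => hx.1.2⟩
  -- The bound must also be nonnegative, since the supremum of an empty set of reals is `0` by
  -- convention.
  refine Real.sSup_le (fun x hx => le_csSup hb ⟨hx.1, ?_⟩)
    (Real.sSup_nonneg fun x hx => hx.1.1)
  exact Set.mem_biUnion hL hx.2

lemma axisThreshold_region_le (hF : Fintype.card F = 2 ^ s)
    (hα : IsPrimitiveRoot α (2 ^ s - 1)) (hj : j ∣ s) (lam rho : DegreeDist) :
    axisThreshold s j (region s lam rho α) ≤ (s : ℝ) / j * (1 - designRate lam rho) := by
  have hs := pos_of_card hF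
  refine Real.sSup_le (fun x hx => le_of_single_mem_region hF hα (Nat.pos_of_dvd_of_pos hj hs)
    (Nat.le_of_dvd hs hj) hx.2) ?_
  rw [designRate, sub_sub_cancel]
  exact mul_nonneg (by positivity) (div_nonneg rho.integral_pos.le lam.integral_pos.le)

end Optimality

end QMBC

theorem theorem5 {F : Type*} [Field F] [Fintype F] [DecidableEq F] (s j : ℕ)
    (hF : Fintype.card F = 2 ^ s) (α : F) (hα : IsPrimitiveRoot α (2 ^ s - 1)) (hj : j ∣ s) :
    -- the labels form a probability distribution
    QMBC.optLabels α s j ∈ stdSimplex ℝ Fˣ ∧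
    (∀ lam rho : QMBC.DegreeDist,
      -- density evolution reduces to the scalar recursion for the probability of `M_0^j`
      (∀ ε ∈ Set.Icc (0 : ℝ) 1,
        ∃ y : ℕ → ℝ,
          y 0 = ε ∧
          (∀ l, y (l + 1) = ε * lam.eval (1 - rho.eval (1 - y l * j / s))) ∧
          ∀ l, QMBC.vtcProb lam rho α (QMBC.optLabels α s j) (QMBC.single s j ε) l
                (QMBC.chanSubgroup α j) = y l ∧
              QMBC.vtcProb lam rho α (QMBC.optLabels α s j) (QMBC.single s j ε) l ⊥ = 1 - y l ∧
              (∀ H, H ≠ ⊥ → H ≠ QMBC.chanSubgroup α j →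
                QMBC.vtcProb lam rho α (QMBC.optLabels α s j) (QMBC.single s j ε) l H = 0) ∧
              QMBC.errorProb lam rho α (QMBC.optLabels α s j) (QMBC.single s j ε) l = y l) ∧
      -- the decodable values of `ε_j` are those for which `ε_j * j / s` is decodable on the BEC
      (∀ ε ∈ Set.Icc (0 : ℝ) 1,
        QMBC.single s j ε ∈ QMBC.labelRegion s lam rho α (QMBC.optLabels α s j) ↔
          Filter.Tendsto (QMBC.bec lam rho (ε * j / s)) Filter.atTop (nhds 0)) ∧
      -- the threshold is `s / j` times the BEC threshold (as long as this is a probability)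
      QMBC.axisThreshold s j (QMBC.labelRegion s lam rho α (QMBC.optLabels α s j)) =
        min 1 ((s : ℝ) / j * QMBC.becThreshold lam rho)) ∧
    -- optimality: ensembles achieving capacity on BEC(δ) achieve capacity on the multi-bit
    -- channel with `ε_j = (s / j) δ`, and no choice of label distributions has asymptotically
    -- a larger threshold
    (∀ (lam rho : ℕ → QMBC.DegreeDist) (δ : ℝ), (s : ℝ) / j * δ ≤ 1 →
      QMBC.BECCapacityAchieving lam rho δ →
        Filter.Tendsto (fun n => QMBC.axisThreshold s j
          (QMBC.labelRegion s (lam n) (rho n) α (QMBC.optLabels α s j)))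
          Filter.atTop (nhds ((s : ℝ) / j * δ)) ∧
        Filter.Tendsto (fun n => QMBC.designRate (lam n) (rho n)) Filter.atTop
          (nhds (QMBC.capacity s (QMBC.single s j ((s : ℝ) / j * δ)))) ∧
        Filter.Tendsto (fun n => QMBC.axisThreshold s j (QMBC.region s (lam n) (rho n) α))
          Filter.atTop (nhds ((s : ℝ) / j * δ))) := by
  have hs := QMBC.pos_of_card hF
  have hj0 := Nat.pos_of_dvd_of_pos hj hs
  have hjs := Nat.le_of_dvd hs hj
  have hL := QMBC.optLabels_mem_stdSimplex hF hα hj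
  refine ⟨hL, fun lam rho => ⟨fun ε hε => ?_, fun ε hε => ?_, ?_⟩,
    fun lam rho δ hδ h => ⟨?_, ?_, ?_⟩⟩
  · refine ⟨QMBC.scalarDE lam rho (j / s) ε, rfl, fun l => ?_, fun l => ?_⟩
    · rw [QMBC.scalarDE, mul_div_assoc]
    · obtain ⟨h1, h2⟩ := QMBC.vtcProb_optLabels hF hα hj lam rho hε l
      refine ⟨h1, QMBC.vtcProb_optLabels_bot hF hα hj lam rho hε l, fun H hH hH' => ?_,
        QMBC.errorProb_optLabels hF hα hj lam rho hε l⟩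
      by_contra hn
      exact (h2 H hn).elim hH hH'
  · exact QMBC.single_mem_labelRegion_iff hF hα hj lam rho hε
  · exact QMBC.axisThreshold_optLabels lam rho hF hα hj
  · exact QMBC.tendsto_axisThreshold_optLabels hF hα hj hδ h.1
  -- Nonnegativity of `δ` follows from its being a limit of thresholds; it places `(s / j) δ` in the
  -- unit interval, where the capacity is `1 - δ`.
  · have hδ0 : 0 ≤ δ := ge_of_tendsto' h.1 fun n => QMBC.becThreshold_nonneg (lam n) (rho n)
    have hs' : (s : ℝ) ≠ 0 := by exact_mod_cast hs.ne'
    have hj' : (j : ℝ) ≠ 0 := by exact_mod_cast hj0.ne'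
    have e : (s : ℝ) / j * δ * j / s = δ := by field_simp
    rw [QMBC.capacity_single hj0 hjs ⟨by positivity, hδ⟩, e]
    exact h.2
  -- Squeeze: the threshold under `optLabels` bounds the full threshold from below and `(s / j)(1 -
  -- R)` from above, and both tend to `(s / j) δ`.
  · have h1 := ((h.2.const_sub 1).const_mul ((s : ℝ) / j))
    rw [sub_sub_cancel] at h1
    exact tendsto_of_tendsto_of_tendsto_of_le_of_le
      (QMBC.tendsto_axisThreshold_optLabels hF hα hj hδ h.1) h1
      (fun n => QMBC.axisThreshold_labelRegion_le _ _ hL)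
      (fun n => QMBC.axisThreshold_region_le hF hα hj _ _)
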